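/- For a real square matrix $M$ write $M^s=(M+M^\top)/2$, and let $\|M\|_F$ and $\|M\|_{op}$ be its Frobenius norm and its Euclidean operator norm. Let $z\sim N(0,I_n)$, and let $f:\mathbb R^n\to\mathbb R^n$ have coordinates $f_1,\dots,f_n$ that are weakly differentiable with $E[f_j(z)^2]+E[\|\nabla f_j(z)\|^2]<\infty$ for every $j$. Let $\nabla f$ be the $n\times n$ matrix with columns $\nabla f_1,\dots,\nabla f_n$, let $\operatorname{div} f=\operatorname{tr}\nabla f$, and put $$\xi=z^\top f(z)-\operatorname{div}f(z),\qquad \xi_{\mu,A}=z^\top(\mu+Az)-\operatorname{tr}A\quad(\mu\in\mathbb R^n,\ A\in\mathbb R^{n\times n}),$$ $$\bar\mu=E[f(z)],\qquad \bar A=E[\nabla f(z)],$$ $\mathcal H_1=\{\xi_{\mu,0}:\mu\in\mathbb R^n\}$, $\mathcal H_2=\{\xi_{0,A}:A\in\mathbb R^{n\times n}\}$ and $\mathcal H_{1,2}=\{\xi_{\mu,A}:\mu\in\mathbb R^n,A\in\mathbb R^{n\times n}\}$, which are subspaces of $L_2$. (1) $\xi\in L_2$, the $L_2$ projection of $\xi$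 onto $\mathcal H_{1,2}$ is $\xi_{\bar\mu,\bar A}$, and $$E[(\xi-\xi_{\bar\mu,\bar A})^2]=E\big[\|f(z)-\bar\mu\|^2-\|\bar A\|_F^2\big]+E\operatorname{tr}\big[\{\nabla f(z)-\bar A\}^2\big]\le 2E\big[\|\{\nabla f(z)-\bar A\}^s\|_F^2\big].$$ The projection of both $\xi$ and $\xi_{\bar\mu,\bar A}$ onto $\mathcal H_1$ is $\xi_{\bar\mu,0}$, with $E[(\xi_{\bar\mu,\bar A}-\xi_{\bar\mu,0})^2]=2\|\bar A^s\|_F^2$. The projection of both $\xi$ and $\xi_{\bar\mu,\bar A}$ onto $\mathcal H_2$ is $\xi_{0,\bar A}$, with $E[(\xi_{\bar\mu,\bar A}-\xi_{0,\bar A})^2]=\|\bar\mu\|^2$. (2) If $E[\xi^2]>0$, then $\varepsilon_{1,2}^2:=1-E[\xi_{\bar\mu,\bar A}^2]/E[\xi^2]$ and $\varepsilon_2^2:=1-E[\xi_{0,\bar A}^2]/E[\xi^2]$ satisfy $$\varepsilon_{1,2}^2\le\frac{2E[\|\{\nabla f(z)-\bar A\}^s\|_F^2]}{\|\bar\mu\|^2+2E[\|\{\nabla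 f(z)\}^s\|_F^2]},\qquad \varepsilon_2^2\le\frac{\|\bar\mu\|^2+2E[\|\{\nabla f(z)-\bar A\}^s\|_F^2]}{\|\bar\mu\|^2+2E[\|\{\nabla f(z)\}^s\|_F^2]}.$$ (3) Consider a sequence of such triples $(n,z,f)$, in which the dimension, the function and the probability space may all vary, with $\operatorname{Var}[\xi]>0$ for all but finitely many terms. Limits are taken along the sequence. If $\varepsilon_{1,2}^2\to0$, then $$\frac{\|\bar A^s\|_{op}^2}{\|\bar\mu\|^2+\|\bar A^s\|_F^2}\to0\iff\frac{\xi}{\operatorname{Var}[\xi]^{1/2}}\to^d N(0,1).$$ If $\varepsilon_2^2\to0$, then $$\frac{\|\bar A^s\|_{op}^2}{\|\bar A^s\|_F^2}\to0\iff\frac{\xi}{\operatorname{Var}[\xi]^{1/2}}\to^d N(0,1).$$ -/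

import Mathlib

open MeasureTheory ProbabilityTheory Filter
open scoped Topology

noncomputable section

namespace QuadApprox

/-- `ℝⁿ` with its Euclidean norm. -/
abbrev E (n : ℕ) : Type := EuclideanSpace ℝ (Fin n)

/-- Real `n × n` matrices. -/
abbrev Mat (n : ℕ) : Type := Matrix (Fin n) (Fin n) ℝ

/-! ### Matrices -/

/-- The symmetrization `Mˢ = (M + Mᵀ) / 2`. -/
def symPart {n : ℕ} (M : Mat n) : Mat n := (1 / 2 : ℝ) • (M + M.transpose)

/-- The squared Frobenius norm `‖M‖_F²`. -/
def frobSq {n : ℕ} (M : Mat n) : ℝ := ∑ i, ∑ j, M i j ^ 2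

/-- The operator norm of `M` for the Euclidean norm. -/
def opNorm {n : ℕ} (M : Mat n) : ℝ := ‖Matrix.toEuclideanCLM (n := Fin n) (𝕜 := ℝ) M‖

/-! ### Weak gradients and the class of functions `f` -/

/-- `g` is a weak partial derivative of `u : ℝⁿ → ℝ` in the `i`-th coordinate direction:
both are locally integrable, and `∫ u ∂ᵢφ = - ∫ g φ` for all test functions `φ ∈ C_c^∞(ℝⁿ)`. -/
def IsWeakPartial {n : ℕ} (u : E n → ℝ) (i : Fin n) (g : E n → ℝ) : Prop :=
  LocallyIntegrable u ∧ LocallyIntegrable g ∧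
    ∀ φ : E n → ℝ, ContDiff ℝ (⊤ : ℕ∞) φ → HasCompactSupport φ →
      ∫ x, u x * fderiv ℝ φ x (EuclideanSpace.single i 1) = -∫ x, g x * φ x

/-- `F` is (a version of) the weak gradient `∇f` of `f : ℝⁿ → ℝⁿ`. Its `j`-th column is the weak
gradient of the coordinate `f_j`, i.e. `F x i j = ∂ᵢ f_j (x)`. -/
def IsWeakGradient {n : ℕ} (f : E n → E n) (F : E n → Mat n) : Prop :=
  ∀ i j, IsWeakPartial (fun x => f x j) i (fun x => F x i j)

/-- The coordinates of `f` are square integrable and weakly differentiable with square integrable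
gradient (columns of `F`), with respect to the standard Gaussian measure of `ℝⁿ`. -/
structure IsGaussianSobolev {n : ℕ} (f : E n → E n) (F : E n → Mat n) : Prop where
  isWeakGradient : IsWeakGradient f F
  memLp : ∀ j, MemLp (fun x => f x j) 2 (stdGaussian (E n))
  memLp_gradient : ∀ i j, MemLp (fun x => F x i j) 2 (stdGaussian (E n))

/-! ### The random variables -/

/-- `x ↦ xᵀ f(x) - div f(x)`, where `div f = trace (∇f)`; then `ξ = steinFun f ∇f (z)`. -/
def steinFun {n : ℕ} (f : E n → E n) (F : E n → Mat n) (x : E n) : ℝ :=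
  inner ℝ x (f x) - (F x).trace

/-- `x ↦ xᵀ (μ + A x) - trace A`; then `ξ_{μ,A} = quadFun μ A (z)`. -/
def quadFun {n : ℕ} (μ : E n) (A : Mat n) (x : E n) : ℝ :=
  inner ℝ x (μ + Matrix.toEuclideanCLM (n := Fin n) (𝕜 := ℝ) A x) - A.trace

lemma quadFun_add {n : ℕ} (μ ν : E n) (A B : Mat n) :
    quadFun (μ + ν) (A + B) = quadFun μ A + quadFun ν B := by
  funext x
  simp only [quadFun, Pi.add_apply, map_add, add_apply, inner_add_right,
    Matrix.trace_add]
  ring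

lemma quadFun_smul {n : ℕ} (c : ℝ) (μ : E n) (A : Mat n) :
    quadFun (c • μ) (c • A) = c • quadFun μ A := by
  funext x
  simp only [quadFun, Pi.smul_apply, map_smul, smul_apply, inner_add_right,
    inner_smul_right, Matrix.trace_smul, smul_eq_mul]
  ring

lemma memLp_quadFun {n : ℕ} (μ : E n) (A : Mat n) :
    MemLp (quadFun μ A) 2 (stdGaussian (E n)) := by
  have : ENNReal.HolderTriple 4 4 2 := ⟨by
    rw [← ENNReal.toReal_eq_toReal_iff' (by simp) (by simp),
      ENNReal.toReal_add (by simp) (by simp)]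
    norm_num [ENNReal.toReal_inv]⟩
  have hid : MemLp (id : E n → E n) 4 (stdGaussian (E n)) := IsGaussian.memLp_id _ 4 (by simp)
  set L := Matrix.toEuclideanCLM (n := Fin n) (𝕜 := ℝ) A
  have hbound : MemLp ((fun x : E n => ‖μ + L (id x)‖) * fun x => ‖id x‖) 2
      (stdGaussian (E n)) :=
    MemLp.mul hid.norm (((memLp_const μ).add (L.comp_memLp' hid)).norm)
  have hinner : MemLp (fun x : E n => (inner ℝ x (μ + L x) : ℝ)) 2 (stdGaussian (E n)) := by
    refine hbound.mono (by fun_prop) (ae_of_all _ fun x => ?_)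
    simpa [mul_comm] using abs_real_inner_le_norm x (μ + L x)
  exact hinner.sub (memLp_const A.trace)

section Random

variable {Ω : Type*} [MeasurableSpace Ω]

lemma memLp_quadFun_comp {n : ℕ} {P : Measure Ω} {z : Ω → E n}
    (hz : HasLaw z (stdGaussian (E n)) P) (μ : E n) (A : Mat n) :
    MemLp (fun ω => quadFun μ A (z ω)) 2 P := by
  have h := memLp_quadFun μ A
  rw [← hz.map_eq] at h
  exact h.comp_of_map hz.aemeasurable

/-- The linear map `(μ, A) ↦ ξ_{μ,A} = zᵀ (μ + A z) - trace A` into `L²(P)`, for a standard normal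
random vector `z`. -/
def quadLp {n : ℕ} {P : Measure Ω} {z : Ω → E n} (hz : HasLaw z (stdGaussian (E n)) P) :
    (E n × Mat n) →ₗ[ℝ] Lp ℝ 2 P where
  toFun p := (memLp_quadFun_comp hz p.1 p.2).toLp (fun ω => quadFun p.1 p.2 (z ω))
  map_add' p q := by
    rw [← MemLp.toLp_add]
    congr 1
    funext ω
    exact congrFun (quadFun_add p.1 q.1 p.2 q.2) (z ω)
  map_smul' c p := by
    rw [RingHom.id_apply, ← MemLp.toLp_const_smul]
    congr 1
    funext ω
    exact congrFun (quadFun_smul c p.1 p.2) (z ω)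

/-- `H₁ = {μᵀ z : μ ∈ ℝⁿ}`, a subspace of `L²(P)`. -/
def chaos1 {n : ℕ} {P : Measure Ω} {z : Ω → E n} (hz : HasLaw z (stdGaussian (E n)) P) :
    Submodule ℝ (Lp ℝ 2 P) :=
  LinearMap.range (quadLp hz ∘ₗ LinearMap.inl ℝ (E n) (Mat n))

/-- `H₂ = {zᵀ A z - trace A : A ∈ ℝⁿˣⁿ}`, a subspace of `L²(P)`. -/
def chaos2 {n : ℕ} {P : Measure Ω} {z : Ω → E n} (hz : HasLaw z (stdGaussian (E n)) P) :
    Submodule ℝ (Lp ℝ 2 P) :=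
  LinearMap.range (quadLp hz ∘ₗ LinearMap.inr ℝ (E n) (Mat n))

/-- `H_{1,2} = {ξ_{μ,A} : μ ∈ ℝⁿ, A ∈ ℝⁿˣⁿ}`, a subspace of `L²(P)`. -/
def chaos12 {n : ℕ} {P : Measure Ω} {z : Ω → E n} (hz : HasLaw z (stdGaussian (E n)) P) :
    Submodule ℝ (Lp ℝ 2 P) :=
  LinearMap.range (quadLp hz)

instance finiteDimensional_chaos1 {n : ℕ} {P : Measure Ω} {z : Ω → E n} (hz : HasLaw z (stdGaussian (E n)) P) :
    FiniteDimensional ℝ (chaos1 hz) :=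
  inferInstanceAs (FiniteDimensional ℝ (LinearMap.range (quadLp hz ∘ₗ LinearMap.inl ℝ _ _)))

instance finiteDimensional_chaos2 {n : ℕ} {P : Measure Ω} {z : Ω → E n} (hz : HasLaw z (stdGaussian (E n)) P) :
    FiniteDimensional ℝ (chaos2 hz) :=
  inferInstanceAs (FiniteDimensional ℝ (LinearMap.range (quadLp hz ∘ₗ LinearMap.inr ℝ _ _)))

instance finiteDimensional_chaos12 {n : ℕ} {P : Measure Ω} {z : Ω → E n} (hz : HasLaw z (stdGaussian (E n)) P) :
    FiniteDimensional ℝ (chaos12 hz) :=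
  inferInstanceAs (FiniteDimensional ℝ (LinearMap.range (quadLp hz)))

/-- `μ̄ = E[f(z)]`. -/
def meanVec {n : ℕ} (P : Measure Ω) (z : Ω → E n) (f : E n → E n) : E n := ∫ ω, f (z ω) ∂P

/-- `Ā = E[∇f(z)]`, entry by entry. -/
def meanMat {n : ℕ} (P : Measure Ω) (z : Ω → E n) (F : E n → Mat n) : Mat n :=
  Matrix.of fun i j => ∫ ω, F (z ω) i j ∂P

/-- `ε² = 1 - E[ξ̄²] / E[ξ²]`: the squared relative error (squared sine of the `L²`-angle) when
`ξ̄` is the `L²` projection of `ξ`. It is only meaningful for `E[ξ²] > 0`. -/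
def relErrSq (P : Measure Ω) (ξ ξbar : Ω → ℝ) : ℝ :=
  1 - (∫ ω, ξbar ω ^ 2 ∂P) / ∫ ω, ξ ω ^ 2 ∂P

end Random

end QuadApprox

end

open QuadApprox

/-! The operator `f ↦ zᵀ f - div f` is the adjoint of the gradient in Gaussian space. Integrating by
parts twice gives the isometry `E[ξ_f ξ_g] = E[f·g] + E tr(∇f ∇g)`
(`IsGaussianSobolev.integral_steinFun_mul`). With `g` affine, Stein's identity `E[z_k f_i] = E[∂_k
f_i]` shows that the covariance of `ξ` with any `ξ_{ν,B}` depends only on `E f` and `E ∇f`. Hence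
`ξ` and `ξ_{μ̄,Ā}` have the same covariances with all quadratic polynomials, which yields every
projection at once, and the error formula is the isometry minus `E[ξ_{μ̄,Ā}²]`. The upper bound on
the error is the Gaussian Poincaré inequality applied to each coordinate of `f`. The relative errors
are then bounded by monotonicity of `a ↦ (d + a)/(c + a)`.

For weakly differentiable `f` the isometry needs an approximation argument. Cutoff and mollification
make test functions dense in the Gaussian Sobolev space (`IsSobolev.exists_test`). The isometry for
test functions makes the images `xᵢ v - ∂ᵢ v` Cauchy in `L²`, and their limit is identified through
`L¹` (`IsSobolev.exists_test_seq_creation`). Poincaré is proved for test functions by rotating one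
Gaussian vector into an independent copy (`poincare_test`).

For asymptotic normality, a vanishing relative error means that the characteristic functions of the
normalized `ξ` and of its normalized quadratic approximation have the same limits. Diagonalizing the
symmetric part turns the approximation into a sum of independent terms `cᵢ xᵢ + lᵢ (xᵢ² - 1)` with
explicit characteristic functions (`exists_charFun_quadFun`). If `max |lᵢ| → 0`, a second-order
expansion gives the Gaussian limit. Conversely, the log-modulus at `t = 1` plus half the variance is
a sum of nonnegative terms that each bound one `lᵢ²` from above through an increasing function, so a
Gaussian limit forces `max |lᵢ| → 0` (`tendsto_charFun_quadFun_iff`). Both asymptotic claims are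
instances of `tendsto_opNorm_iff_tendstoInDistribution`. -/

namespace QuadApprox

/-! ### The density of the standard Gaussian measure -/

/-- The Lebesgue density of the standard Gaussian measure of `ℝⁿ`. -/
noncomputable def gaussianDensity {n : ℕ} (x : E n) : ℝ :=
  (∫ y : E n, Real.exp (-(1 / 2) * ‖y‖ ^ 2))⁻¹ * Real.exp (-(1 / 2) * ‖x‖ ^ 2)

lemma integral_exp_neg_half_sq_pos (n : ℕ) :
    0 < ∫ y : E n, Real.exp (-(1 / 2) * ‖y‖ ^ 2) := by
  rw [GaussianFourier.integral_rexp_neg_mul_sq_norm (by norm_num)]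
  positivity

lemma gaussianDensity_pos {n : ℕ} (x : E n) : 0 < gaussianDensity x :=
  mul_pos (inv_pos.2 (integral_exp_neg_half_sq_pos n)) (Real.exp_pos _)

lemma contDiff_gaussianDensity {n : ℕ} :
    ContDiff ℝ (⊤ : ℕ∞) (gaussianDensity : E n → ℝ) := by
  unfold gaussianDensity
  exact contDiff_const.mul (Real.contDiff_exp.comp (contDiff_const.mul (contDiff_norm_sq ℝ)))

lemma continuous_gaussianDensity {n : ℕ} : Continuous (gaussianDensity : E n → ℝ) :=
  contDiff_gaussianDensity.continuous

/-- The logarithmic derivative of the density is `-x`; this converts Lebesgue weak derivatives into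
Gaussian integration by parts. -/
lemma fderiv_gaussianDensity {n : ℕ} (x v : E n) :
    fderiv ℝ gaussianDensity x v = -inner ℝ x v * gaussianDensity x := by
  have h : HasFDerivAt (gaussianDensity : E n → ℝ)
      ((∫ y : E n, Real.exp (-(1 / 2) * ‖y‖ ^ 2))⁻¹ •
        (Real.exp (-(1 / 2) * ‖x‖ ^ 2) • ((-(1 / 2) : ℝ) • ((2 : ℝ) • (innerSL ℝ x))))) x := by
    have h1 : HasFDerivAt (fun y : E n => ‖y‖ ^ 2) ((2 : ℝ) • innerSL ℝ x) x := by
      simpa only [← Nat.cast_smul_eq_nsmul ℝ, Nat.cast_ofNat]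
        using (hasStrictFDerivAt_norm_sq x).hasFDerivAt
    exact ((h1.const_mul (-(1 / 2) : ℝ)).exp).const_mul _
  rw [h.fderiv]
  simp [gaussianDensity]
  ring

/-- Both measures are finite, so it suffices to compare characteristic functions. The normalizing
constant is the zero-frequency case of the same Fourier integral and cancels. -/
lemma stdGaussian_eq_withDensity (n : ℕ) :
    stdGaussian (E n) = volume.withDensity (fun x => ENNReal.ofReal (gaussianDensity x)) := by
  have hint : Integrable (fun x : E n => gaussianDensity x) := by
    have := GaussianFourier.integrable_cexp_neg_mul_sq_norm_add (V := E n) (b := 1 / 2)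
      (by norm_num) 0 0
    refine Integrable.const_mul ?_ _
    refine this.re.congr (ae_of_all _ fun x => ?_)
    have : (-(1 / 2 : ℂ) * (‖x‖ : ℂ) ^ 2 + 0 * ((inner ℝ (0 : E n) x : ℝ) : ℂ)) =
      ((-(1 / 2) * ‖x‖ ^ 2 : ℝ) : ℂ) := by push_cast; ring
    simp only [this, ← Complex.ofReal_exp]
    exact Complex.ofReal_re _
  have : IsFiniteMeasure
      ((volume : Measure (E n)).withDensity (fun x => ENNReal.ofReal (gaussianDensity x))) :=
    isFiniteMeasure_withDensity_ofReal hint.2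
  refine Measure.ext_of_charFun ?_
  ext t
  rw [charFun_stdGaussian, charFun_apply, integral_withDensity_eq_integral_toReal_smul
    continuous_gaussianDensity.measurable.ennreal_ofReal (by simp)]
  have key := GaussianFourier.integral_cexp_neg_mul_sq_norm_add (V := E n) (b := 1 / 2)
      (by norm_num) Complex.I t
  have hc : ((∫ y : E n, Real.exp (-(1 / 2) * ‖y‖ ^ 2) : ℝ) : ℂ) =
      (Real.pi / (1 / 2 : ℂ)) ^ (Module.finrank ℝ (E n) / 2 : ℂ) := by
    have h := GaussianFourier.integral_cexp_neg_mul_sq_norm (V := E n) (b := 1 / 2) (by norm_num)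
    rw [← h, ← integral_complex_ofReal]
    congr with x
    push_cast
    rfl
  have hc0 : ((∫ y : E n, Real.exp (-(1 / 2) * ‖y‖ ^ 2) : ℝ) : ℂ) ≠ 0 :=
    Complex.ofReal_ne_zero.2 (integral_exp_neg_half_sq_pos n).ne'
  rw [← hc] at key
  have : ∀ x : E n, (ENNReal.ofReal (gaussianDensity x)).toReal •
      Complex.exp ((inner ℝ x t : ℝ) * Complex.I) =
      ((∫ y : E n, Real.exp (-(1 / 2) * ‖y‖ ^ 2) : ℝ) : ℂ)⁻¹ *
        Complex.exp (-(1 / 2) * ‖x‖ ^ 2 + Complex.I * (inner ℝ t x : ℝ)) := by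
    intro x
    rw [ENNReal.toReal_ofReal (gaussianDensity_pos x).le, Complex.real_smul, gaussianDensity,
      Complex.exp_add, real_inner_comm, mul_comm Complex.I]
    push_cast
    ring
  simp_rw [this]
  rw [integral_const_mul, key, inv_mul_cancel_left₀ hc0, Complex.I_sq]
  congr 1
  ring

lemma integral_stdGaussian_eq {n : ℕ} (h : E n → ℝ) :
    ∫ x, h x ∂(stdGaussian (E n)) = ∫ x, h x * gaussianDensity x := by
  rw [stdGaussian_eq_withDensity, integral_withDensity_eq_integral_toReal_smul
    continuous_gaussianDensity.measurable.ennreal_ofReal (by simp)]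
  refine integral_congr_ae (ae_of_all _ fun x => ?_)
  simp only [ENNReal.toReal_ofReal (gaussianDensity_pos x).le, smul_eq_mul, mul_comm]

lemma volume_absolutelyContinuous_stdGaussian (n : ℕ) :
    (volume : Measure (E n)) ≪ stdGaussian (E n) := by
  rw [stdGaussian_eq_withDensity]
  exact withDensity_absolutelyContinuous'
    continuous_gaussianDensity.measurable.ennreal_ofReal.aemeasurable
    (ae_of_all _ fun x => by simpa using gaussianDensity_pos x)

/-- The density is largest at the origin. This passes Lebesgue `L²` convergence of mollifications to
the Gaussian measure. -/
lemma exists_stdGaussian_le_smul_volume (n : ℕ) :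
    ∃ C : ENNReal, C ≠ ⊤ ∧ stdGaussian (E n) ≤ C • (volume : Measure (E n)) := by
  refine ⟨ENNReal.ofReal (∫ y : E n, Real.exp (-(1 / 2) * ‖y‖ ^ 2))⁻¹, by simp, ?_⟩
  rw [stdGaussian_eq_withDensity, ← withDensity_const]
  refine withDensity_mono (ae_of_all _ fun x => ENNReal.ofReal_le_ofReal ?_)
  refine mul_le_of_le_one_right (inv_nonneg.2 (integral_exp_neg_half_sq_pos n).le) ?_
  rw [Real.exp_le_one_iff]
  nlinarith [sq_nonneg ‖x‖]

/-- On a compact set, Lebesgue measure is dominated by a multiple of the Gaussian measure. -/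
lemma exists_volume_restrict_le_smul_stdGaussian {n : ℕ} {K : Set (E n)} (hK : IsCompact K) :
    ∃ C : ENNReal, C ≠ ⊤ ∧ (volume : Measure (E n)).restrict K ≤ C • stdGaussian (E n) := by
  obtain ⟨c, hc, hcK⟩ : ∃ c > 0, ∀ x ∈ K, c ≤ gaussianDensity x := by
    rcases K.eq_empty_or_nonempty with rfl | hne
    · exact ⟨1, one_pos, by simp⟩
    · obtain ⟨x, -, hx⟩ := hK.exists_isMinOn hne continuous_gaussianDensity.continuousOn
      exact ⟨_, gaussianDensity_pos x, hx⟩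
  refine ⟨ENNReal.ofReal c⁻¹, by simp, ?_⟩
  refine Measure.le_iff.2 fun s hs => ?_
  rw [Measure.restrict_apply hs, Measure.smul_apply, stdGaussian_eq_withDensity,
    withDensity_apply _ hs, smul_eq_mul]
  calc volume (s ∩ K) = ENNReal.ofReal c⁻¹ * ∫⁻ _ in s ∩ K, ENNReal.ofReal c := by
        rw [setLIntegral_const, ← mul_assoc, ← ENNReal.ofReal_mul (inv_nonneg.2 hc.le),
          inv_mul_cancel₀ hc.ne', ENNReal.ofReal_one, one_mul]
    _ ≤ ENNReal.ofReal c⁻¹ * ∫⁻ x in s ∩ K, ENNReal.ofReal (gaussianDensity x) := by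
        gcongr ENNReal.ofReal c⁻¹ * ?_
        exact setLIntegral_mono' (hs.inter hK.measurableSet)
          fun x hx => ENNReal.ofReal_le_ofReal (hcK x hx.2)
    _ ≤ _ := by
        gcongr
        exact Set.inter_subset_left

end QuadApprox

namespace QuadApprox

/-! ### Mollification in `L²` -/

open ContinuousLinearMap (lsmul)
open scoped Convolution

/-- Translation is an additive action on the domain, and this action is continuous on `Lp` for
finite exponents. -/
lemma tendsto_eLpNorm_translate_sub {n : ℕ} {w : E n → ℝ} (hw : MemLp w 2) :
    Tendsto (fun t : E n => eLpNorm (fun x => w (x - t) - w x) 2) (𝓝 0) (𝓝 0) := by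
  have : Fact ((2 : ENNReal) ≠ ⊤) := ⟨by simp⟩
  have hc : Continuous fun t : E n => (DomAddAct.mk (-t)) +ᵥ hw.toLp w :=
    (DomAddAct.continuous_mk.comp continuous_neg).vadd continuous_const
  have h0 := (hc.tendsto 0)
  rw [neg_zero, DomAddAct.mk_zero, zero_vadd, Lp.tendsto_Lp_iff_tendsto_eLpNorm'] at h0
  refine h0.congr fun t => eLpNorm_congr_ae ?_
  rw [DomAddAct.mk_vadd_toLp]
  filter_upwards [MemLp.coeFn_toLp hw,
    MemLp.coeFn_toLp (hw.comp_measurePreserving (measurePreserving_vadd (-t) volume))] with x h1 h2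
  rw [Pi.sub_apply, h1]
  refine (congrArg (· - w x) h2).trans ?_
  simp [sub_eq_neg_add]

lemma eLpNorm_two_sq {α : Type*} [MeasurableSpace α] (μ : Measure α) (v : α → ℝ) :
    eLpNorm v 2 μ ^ 2 = ∫⁻ x, ‖v x‖ₑ ^ 2 ∂μ := by
  have := eLpNorm_nnreal_pow_eq_lintegral (μ := μ) (f := v) (p := 2) (by norm_num)
  simpa using this

/-- The probability measure whose density is a normalized bump function. -/
noncomputable def bumpMeasure {n : ℕ} (φ : ContDiffBump (0 : E n)) : Measure (E n) :=
  volume.withDensity fun t => ENNReal.ofReal (φ.normed volume t)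

instance isProbabilityMeasure_bumpMeasure {n : ℕ} (φ : ContDiffBump (0 : E n)) :
    IsProbabilityMeasure (bumpMeasure φ) := by
  refine ⟨?_⟩
  rw [bumpMeasure, withDensity_apply _ MeasurableSet.univ, Measure.restrict_univ,
    ← ofReal_integral_eq_lintegral_ofReal φ.integrable_normed (ae_of_all _ φ.nonneg_normed),
    φ.integral_normed, ENNReal.ofReal_one]

lemma measurable_ofReal_normed {n : ℕ} (φ : ContDiffBump (0 : E n)) :
    Measurable fun t => ENNReal.ofReal (φ.normed (volume : Measure (E n)) t) :=
  φ.continuous_normed.measurable.ennreal_ofReal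

/-- The kernel has total mass one, so the constant `w x` may be averaged along with the translates.
-/
lemma convolution_normed_sub_eq_integral {n : ℕ} {w : E n → ℝ} (hw : LocallyIntegrable w)
    (φ : ContDiffBump (0 : E n)) (x : E n) :
    (w ⋆[lsmul ℝ ℝ] φ.normed volume) x - w x = ∫ t, (w (x - t) - w x) ∂(bumpMeasure φ) := by
  have hex : Integrable fun t => φ.normed volume t * w (x - t) :=
    (φ.hasCompactSupport_normed (μ := volume)).convolutionExists_left
      (lsmul ℝ ℝ) (φ.continuous_normed (μ := volume)) hw x
  rw [bumpMeasure, integral_withDensity_eq_integral_toReal_smul (measurable_ofReal_normed φ)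
    (by simp), convolution_eq_swap]
  have : ∀ t, (ENNReal.ofReal (φ.normed volume t)).toReal • (w (x - t) - w x) =
      φ.normed volume t * w (x - t) - φ.normed volume t * w x := by
    intro t
    rw [ENNReal.toReal_ofReal (φ.nonneg_normed t), smul_eq_mul, mul_sub]
  simp_rw [this]
  rw [integral_sub hex (φ.integrable_normed.mul_const _), integral_mul_const,
    φ.integral_normed, one_mul]
  simp [mul_comm]

/-- Jensen's inequality, in the form that `L¹` norms are at most `L²` norms for a probability
measure. -/
lemma enorm_convolution_normed_sub_sq_le {n : ℕ} {w : E n → ℝ} (hw : LocallyIntegrable w)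
    (φ : ContDiffBump (0 : E n)) (x : E n) :
    ‖(w ⋆[lsmul ℝ ℝ] φ.normed volume) x - w x‖ₑ ^ 2 ≤
      ∫⁻ t, ‖w (x - t) - w x‖ₑ ^ 2 ∂(bumpMeasure φ) := by
  have hmeas : AEStronglyMeasurable (fun t => w (x - t) - w x) (bumpMeasure φ) := by
    refine (AEStronglyMeasurable.sub ?_ aestronglyMeasurable_const).mono_ac
      (withDensity_absolutelyContinuous _ _)
    exact hw.aestronglyMeasurable.comp_quasiMeasurePreserving
      (quasiMeasurePreserving_sub_left_of_right_invariant volume x)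
  rw [convolution_normed_sub_eq_integral hw, ← eLpNorm_two_sq]
  gcongr
  refine (enorm_integral_le_lintegral_enorm _).trans ?_
  rw [← eLpNorm_one_eq_lintegral_enorm]
  exact eLpNorm_le_eLpNorm_of_exponent_le (by norm_num) hmeas

lemma aestronglyMeasurable_translate_sub {n : ℕ} {w : E n → ℝ} (hw : AEStronglyMeasurable w)
    (ν : Measure (E n)) [SFinite ν] (hν : ν ≪ volume) :
    AEStronglyMeasurable (fun p : E n × E n => w (p.1 - p.2) - w p.1) (volume.prod ν) := by
  have h1 : AEStronglyMeasurable (fun p : E n × E n => w (p.1 - p.2)) (volume.prod volume) :=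
    hw.comp_quasiMeasurePreserving
      (quasiMeasurePreserving_sub_of_right_invariant volume volume)
  have h2 : AEStronglyMeasurable (fun p : E n × E n => w p.1) (volume.prod volume) := hw.comp_fst
  exact (h1.sub h2).mono_ac (Measure.AbsolutelyContinuous.rfl.prod hν)

lemma lintegral_translate_sub_le {n : ℕ} {w : E n → ℝ} (φ : ContDiffBump (0 : E n)) {η : ENNReal}
    (h : ∀ t ∈ Metric.ball (0 : E n) φ.rOut, eLpNorm (fun x => w (x - t) - w x) 2 ≤ η) :
    ∫⁻ t, ∫⁻ x, ‖w (x - t) - w x‖ₑ ^ 2 ∂volume ∂(bumpMeasure φ) ≤ η ^ 2 := by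
  have h1 : ∀ᵐ t ∂(bumpMeasure φ), ∫⁻ x, ‖w (x - t) - w x‖ₑ ^ 2 ≤ η ^ 2 := by
    refine (ae_withDensity_iff (measurable_ofReal_normed φ)).2 (ae_of_all _ fun t ht => ?_)
    rw [← eLpNorm_two_sq]
    gcongr
    refine h t ?_
    rw [← φ.support_normed_eq (μ := volume)]
    intro h0
    exact ht (by simp [h0])
  refine (lintegral_mono_ae h1).trans ?_
  simp

/-- Integrating the pointwise Jensen bound and exchanging the integrals leaves an average over
translations in the support of the kernel. -/
lemma eLpNorm_convolution_normed_sub_le {n : ℕ} {w : E n → ℝ} (hw : MemLp w 2)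
    (φ : ContDiffBump (0 : E n)) {η : ENNReal}
    (h : ∀ t ∈ Metric.ball (0 : E n) φ.rOut, eLpNorm (fun x => w (x - t) - w x) 2 ≤ η) :
    eLpNorm (fun x => (w ⋆[lsmul ℝ ℝ] φ.normed volume) x - w x) 2 ≤ η := by
  have hmeas := (aestronglyMeasurable_translate_sub hw.1 (bumpMeasure φ)
    (withDensity_absolutelyContinuous _ _)).enorm.pow_const 2
  refine (ENNReal.pow_le_pow_left_iff two_ne_zero).1 ?_
  rw [eLpNorm_two_sq]
  refine (lintegral_mono
    (enorm_convolution_normed_sub_sq_le (hw.locallyIntegrable (by norm_num)) φ)).trans ?_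
  rw [lintegral_lintegral_swap hmeas]
  exact lintegral_translate_sub_le φ h

/-! ### Test functions and weak derivatives -/

/-- The partial derivative `∂ᵢ u` of a differentiable function. -/
noncomputable def pderiv {n : ℕ} (i : Fin n) (u : E n → ℝ) (x : E n) : ℝ :=
  fderiv ℝ u x (EuclideanSpace.single i 1)

/-- Smooth functions with compact support. -/
structure IsTest {n : ℕ} (φ : E n → ℝ) : Prop where
  contDiff : ContDiff ℝ (⊤ : ℕ∞) φ
  hasCompactSupport : HasCompactSupport φ

section Smooth

variable {n : ℕ} {u v φ : E n → ℝ} {i : Fin n}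

lemma contDiff_pderiv (hu : ContDiff ℝ (⊤ : ℕ∞) u) (i : Fin n) :
    ContDiff ℝ (⊤ : ℕ∞) (pderiv i u) :=
  (hu.fderiv_right (m := (⊤ : ℕ∞)) (by exact_mod_cast le_top)).clm_apply contDiff_const

lemma differentiable_of_smooth (hu : ContDiff ℝ (⊤ : ℕ∞) u) : Differentiable ℝ u :=
  hu.differentiable (by simp)

lemma pderiv_mul (hu : ContDiff ℝ (⊤ : ℕ∞) u) (hv : ContDiff ℝ (⊤ : ℕ∞) v) (i : Fin n)
    (x : E n) : pderiv i (fun y => u y * v y) x = pderiv i u x * v x + u x * pderiv i v x := by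
  unfold pderiv
  rw [fderiv_fun_mul (differentiable_of_smooth hu x) (differentiable_of_smooth hv x)]
  simp
  ring

lemma pderiv_sub (hu : ContDiff ℝ (⊤ : ℕ∞) u) (hv : ContDiff ℝ (⊤ : ℕ∞) v) (i : Fin n)
    (x : E n) : pderiv i (fun y => u y - v y) x = pderiv i u x - pderiv i v x := by
  unfold pderiv
  rw [fderiv_fun_sub (differentiable_of_smooth hu x) (differentiable_of_smooth hv x)]
  simp

@[simp]
lemma pderiv_const (i : Fin n) (c : ℝ) (x : E n) : pderiv i (fun _ => c) x = 0 := by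
  simp [pderiv]

lemma contDiff_coord (i : Fin n) : ContDiff ℝ (⊤ : ℕ∞) fun x : E n => x i :=
  contDiff_piLp_apply 2

lemma pderiv_coord (i j : Fin n) (x : E n) :
    pderiv i (fun y : E n => y j) x = if j = i then 1 else 0 := by
  have : HasFDerivAt (fun y : E n => y j) (EuclideanSpace.proj (𝕜 := ℝ) j) x :=
    (EuclideanSpace.proj (𝕜 := ℝ) j).hasFDerivAt
  simp [pderiv, this.fderiv]

/-- Partial derivatives of smooth functions commute. -/
lemma pderiv_comm (hu : ContDiff ℝ (⊤ : ℕ∞) u) (i j : Fin n) (x : E n) :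
    pderiv i (pderiv j u) x = pderiv j (pderiv i u) x := by
  have hd : Differentiable ℝ (fderiv ℝ u) :=
    (hu.fderiv_right (m := (⊤ : ℕ∞)) (by exact_mod_cast le_top)).differentiable (by simp)
  have key : ∀ k l : Fin n, pderiv k (pderiv l u) x =
      fderiv ℝ (fderiv ℝ u) x (EuclideanSpace.single k 1) (EuclideanSpace.single l 1) := by
    intro k l
    have := (hd x).hasFDerivAt.clm_apply (hasFDerivAt_const (EuclideanSpace.single l (1 : ℝ)) x)
    change fderiv ℝ (fun y => fderiv ℝ u y (EuclideanSpace.single l 1)) x _ = _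
    rw [this.fderiv]
    simp
  rw [key, key]
  exact (hu.contDiffAt.isSymmSndFDerivAt (by simpa using WithTop.coe_le_coe.2 (le_top : (2 : ℕ∞) ≤ ⊤))) _ _

lemma IsTest.pderiv (hφ : IsTest φ) (i : Fin n) : IsTest (pderiv i φ) :=
  ⟨contDiff_pderiv hφ.1 i, hφ.2.fderiv_apply ℝ _⟩

lemma IsTest.mul (hu : ContDiff ℝ (⊤ : ℕ∞) u) (hφ : IsTest φ) : IsTest fun x => u x * φ x :=
  ⟨hu.mul hφ.1, hφ.2.mul_left⟩

lemma IsTest.mul_right (hφ : IsTest φ) (hu : ContDiff ℝ (⊤ : ℕ∞) u) : IsTest fun x => φ x * u x :=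
  ⟨hφ.1.mul hu, hφ.2.mul_right⟩

lemma IsTest.sub (hφ : IsTest φ) (hv : IsTest v) : IsTest fun x => φ x - v x :=
  ⟨hφ.1.sub hv.1, hφ.2.sub hv.2⟩

lemma IsTest.memLp (hφ : IsTest φ) (p : ENNReal) (μ : Measure (E n))
    [IsFiniteMeasureOnCompacts μ] : MemLp φ p μ :=
  hφ.1.continuous.memLp_of_hasCompactSupport hφ.2

lemma IsTest.integrable (hφ : IsTest φ) (μ : Measure (E n)) [IsFiniteMeasureOnCompacts μ] :
    Integrable φ μ :=
  hφ.1.continuous.integrable_of_hasCompactSupport hφ.2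

lemma isWeakPartial_of_contDiff (hu : ContDiff ℝ (⊤ : ℕ∞) u) (i : Fin n) :
    IsWeakPartial u i (pderiv i u) := by
  refine ⟨hu.continuous.locallyIntegrable, (contDiff_pderiv hu i).continuous.locallyIntegrable,
    fun φ hφ hφc => ?_⟩
  have ht : IsTest φ := ⟨hφ, hφc⟩
  exact integral_mul_fderiv_eq_neg_fderiv_mul_of_integrable
    ((IsTest.mul (contDiff_pderiv hu i) ht).integrable _)
    ((IsTest.mul hu (ht.pderiv i)).integrable _)
    ((IsTest.mul hu ht).integrable _)
    (fun x _ => differentiable_of_smooth hu x) (fun x _ => differentiable_of_smooth hφ x)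

/-- The product rule for weak derivatives. -/
lemma IsWeakPartial.smooth_mul {g χ : E n → ℝ} (h : IsWeakPartial u i g)
    (hχ : IsTest χ) :
    IsWeakPartial (fun x => χ x * u x) i (fun x => χ x * g x + pderiv i χ x * u x) := by
  obtain ⟨hu, hg, hw⟩ := h
  have hloc : ∀ {a b : E n → ℝ}, IsTest a → LocallyIntegrable b →
      LocallyIntegrable fun x => a x * b x := fun ha hb =>
    (hb.integrable_smul_left_of_hasCompactSupport ha.1.continuous ha.2).locallyIntegrable
  have hint : ∀ {a b : E n → ℝ}, IsTest a → LocallyIntegrable b →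
      Integrable fun x => b x * a x := fun ha hb =>
    (hb.integrable_smul_right_of_hasCompactSupport ha.1.continuous ha.2)
  refine ⟨hloc hχ hu, (hloc hχ hg).add (hloc (hχ.pderiv i) hu), fun φ hφ hφc => ?_⟩
  have ht : IsTest φ := ⟨hφ, hφc⟩
  -- The weak derivative of `u` is tested against `χ φ`; the part of its derivative falling on `χ`
  -- becomes the extra term of the product rule.
  have h1 := hw _ (IsTest.mul hχ.1 ht).1 (IsTest.mul hχ.1 ht).2
  have h2 : ∀ x, u x * fderiv ℝ (fun y => χ y * φ y) x (EuclideanSpace.single i 1) =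
      χ x * u x * fderiv ℝ φ x (EuclideanSpace.single i 1) + u x * (pderiv i χ x * φ x) := by
    intro x
    have := pderiv_mul hχ.1 hφ i x
    simp only [pderiv] at this ⊢
    rw [this]
    ring
  simp_rw [h2] at h1
  have i1 : Integrable fun x => χ x * u x * fderiv ℝ φ x (EuclideanSpace.single i 1) :=
    (hint (IsTest.mul hχ.1 (ht.pderiv i)) hu).congr (ae_of_all _ fun x => by
      simp only [pderiv]; ring)
  have i2 : Integrable fun x => u x * (pderiv i χ x * φ x) :=
    hint (IsTest.mul (hχ.pderiv i).1 ht) hu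
  have i3 : Integrable fun x => g x * (χ x * φ x) := hint (IsTest.mul hχ.1 ht) hg
  rw [integral_add i1 i2] at h1
  have h3 : ∀ x, (χ x * g x + pderiv i χ x * u x) * φ x =
      g x * (χ x * φ x) + u x * (pderiv i χ x * φ x) := fun x => by ring
  simp_rw [h3]
  rw [integral_add i3 i2]
  linarith

/-- Mollification commutes with weak differentiation. -/
lemma IsWeakPartial.pderiv_convolution {g : E n → ℝ} (h : IsWeakPartial u i g) (hφ : IsTest φ)
    (x : E n) : pderiv i (u ⋆[lsmul ℝ ℝ] φ) x = (g ⋆[lsmul ℝ ℝ] φ) x := by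
  obtain ⟨hu, hg, hw⟩ := h
  have hd := hφ.2.hasFDerivAt_convolution_right (lsmul ℝ ℝ) hu (hφ.1.of_le (by simp)) x
  unfold pderiv
  rw [hd.fderiv, convolution_precompR_apply (lsmul ℝ ℝ) hu (hφ.2.fderiv ℝ)
    (hφ.1.continuous_fderiv (by simp))]
  -- The reflected kernel `t ↦ φ (x - t)` serves as test function; the sign from the reflection
  -- cancels the one in the weak derivative.
  have hψ : ContDiff ℝ (⊤ : ℕ∞) fun t => φ (x - t) := hφ.1.comp (contDiff_const.sub contDiff_id)
  have hψc : HasCompactSupport fun t => φ (x - t) :=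
    hφ.2.comp_homeomorph (Homeomorph.subLeft x)
  have h1 := hw _ hψ hψc
  have h2 : ∀ t, fderiv ℝ (fun t => φ (x - t)) t (EuclideanSpace.single i 1) =
      -fderiv ℝ φ (x - t) (EuclideanSpace.single i 1) := by
    intro t
    have := ((differentiable_of_smooth hφ.1 (x - t)).hasFDerivAt).comp t
      ((hasFDerivAt_const x t).sub (hasFDerivAt_id t))
    have h := this.fderiv
    simp only [Function.comp_def] at h
    rw [h]
    simp
  simp_rw [h2] at h1
  simp only [mul_neg, integral_neg, neg_inj] at h1
  simpa [convolution_def] using h1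

end Smooth

end QuadApprox

namespace QuadApprox

/-! ### Density of test functions in the Gaussian Sobolev space -/

open ContinuousLinearMap (lsmul)
open scoped Convolution

/-- The scalar Gaussian Sobolev space: `u` is weakly differentiable with partial derivatives `g i`,
and `u` and all `g i` are square integrable for the standard Gaussian measure. -/
structure IsSobolev {n : ℕ} (u : E n → ℝ) (g : Fin n → E n → ℝ) : Prop where
  isWeakPartial : ∀ i, IsWeakPartial u i (g i)
  memLp : MemLp u 2 (stdGaussian (E n))
  memLp_partial : ∀ i, MemLp (g i) 2 (stdGaussian (E n))

/-- Dominated convergence for the squared norms, with majorant `‖u‖²`; at each point the integrand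
is eventually zero. -/
lemma tendsto_eLpNorm_mul_sub {α : Type*} [MeasurableSpace α] {μ : Measure α} {χ : ℕ → α → ℝ}
    {u : α → ℝ} (hu : MemLp u 2 μ) (hχm : ∀ m, AEStronglyMeasurable (χ m) μ)
    (hχ : ∀ m x, |χ m x - 1| ≤ 1)
    (hlim : ∀ x, ∀ᶠ m in atTop, χ m x = 1) :
    Tendsto (fun m => eLpNorm (fun x => χ m x * u x - u x) 2 μ) atTop (𝓝 0) := by
  have hsq : Tendsto (fun m => eLpNorm (fun x => χ m x * u x - u x) 2 μ ^ 2) atTop (𝓝 0) := by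
    simp_rw [eLpNorm_two_sq]
    have h0 : ∫⁻ _, (0 : ENNReal) ∂μ = 0 := lintegral_zero
    rw [← h0]
    refine tendsto_lintegral_of_dominated_convergence' (fun x => ‖u x‖ₑ ^ 2) (fun m => ?_)
      (fun m => ae_of_all _ fun x => ?_) ?_ (ae_of_all _ fun x => ?_)
    · exact ((((hχm m).mul hu.1).sub hu.1).enorm.pow_const _)
    · beta_reduce
      gcongr
      rw [enorm_le_iff_norm_le, Real.norm_eq_abs, Real.norm_eq_abs,
        show χ m x * u x - u x = (χ m x - 1) * u x by ring, abs_mul]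
      exact mul_le_of_le_one_left (abs_nonneg _) (hχ m x)
    · rw [← eLpNorm_two_sq]
      exact ENNReal.pow_ne_top hu.2.ne
    · refine tendsto_const_nhds.congr' ?_
      filter_upwards [hlim x] with m hm
      simp [hm]
  have := (ENNReal.continuous_rpow_const (y := 1 / 2)).tendsto 0 |>.comp hsq
  simp only [Function.comp_def, ENNReal.zero_rpow_of_pos (show (0 : ℝ) < 1 / 2 by norm_num)] at this
  refine this.congr fun m => ?_
  rw [← ENNReal.rpow_natCast, ← ENNReal.rpow_mul]
  norm_num

/-- A sequence of smooth cutoff functions whose first derivatives tend to zero uniformly. -/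
lemma exists_cutoff (n : ℕ) : ∃ (χ : ℕ → E n → ℝ) (C : ℝ), (∀ m, IsTest (χ m)) ∧
    (∀ m x, |χ m x - 1| ≤ 1) ∧ (∀ x, ∀ᶠ m in atTop, χ m x = 1) ∧
    ∀ m i x, |pderiv i (χ m) x| ≤ C / (m + 1) := by
  let χ : ContDiffBump (0 : E n) := ⟨1, 2, one_pos, one_lt_two⟩
  have hχ : IsTest (χ : E n → ℝ) := ⟨χ.contDiff, χ.hasCompactSupport⟩
  have hbd : ∀ i, ∃ C, ∀ x, ‖pderiv i (χ : E n → ℝ) x‖ ≤ C := fun i =>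
    (hχ.pderiv i).2.exists_bound_of_continuous (hχ.pderiv i).1.continuous
  choose C hC using hbd
  -- Dilating a fixed bump by `m + 1` divides its gradient by `m + 1`. The sum of the bounds is one
  -- constant valid for all coordinates.
  refine ⟨fun m x => χ ((m + 1 : ℝ)⁻¹ • x), ∑ i, |C i|, fun m => ?_, fun m x => ?_, fun x => ?_,
    fun m i x => ?_⟩
  · have hm : (m + 1 : ℝ)⁻¹ ≠ 0 := inv_ne_zero (by positivity)
    exact ⟨hχ.1.comp (contDiff_const_smul _), hχ.2.comp_smul hm⟩
  · rw [abs_sub_comm, abs_of_nonneg (sub_nonneg.2 χ.le_one)]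
    linarith [χ.nonneg' ((m + 1 : ℝ)⁻¹ • x)]
  · filter_upwards [eventually_ge_atTop ⌈‖x‖⌉₊] with m hm
    refine χ.one_of_mem_closedBall ?_
    rw [mem_closedBall_zero_iff, norm_smul, norm_inv, Real.norm_of_nonneg (by positivity)]
    change _ ≤ (1 : ℝ)
    rw [inv_mul_le_one₀ (by positivity)]
    exact (Nat.ceil_le.1 hm).trans (by simp)
  · have hd : HasFDerivAt (fun y : E n => χ ((m + 1 : ℝ)⁻¹ • y))
        ((fderiv ℝ χ ((m + 1 : ℝ)⁻¹ • x)).comp ((m + 1 : ℝ)⁻¹ • ContinuousLinearMap.id ℝ (E n))) x :=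
      (differentiable_of_smooth hχ.1 _).hasFDerivAt.comp x
        ((hasFDerivAt_id x).const_smul ((m + 1 : ℝ)⁻¹))
    rw [pderiv, hd.fderiv]
    simp only [ContinuousLinearMap.comp_apply, smul_apply, ContinuousLinearMap.id_apply, map_smul,
      smul_eq_mul, abs_mul, abs_inv]
    rw [abs_of_nonneg (by positivity : (0 : ℝ) ≤ m + 1), div_eq_inv_mul]
    gcongr
    exact (hC i _).trans ((le_abs_self _).trans
      (Finset.single_le_sum (f := fun i => |C i|) (fun _ _ => abs_nonneg _) (Finset.mem_univ i)))

lemma tendsto_eLpNorm_convolution_normed {n : ℕ} {w : E n → ℝ} (hw : MemLp w 2)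
    {φ : ℕ → ContDiffBump (0 : E n)} (hφ : Tendsto (fun m => (φ m).rOut) atTop (𝓝 0)) :
    Tendsto (fun m => eLpNorm (fun x => (w ⋆[lsmul ℝ ℝ] (φ m).normed volume) x - w x) 2)
      atTop (𝓝 0) := by
  rw [ENNReal.tendsto_nhds_zero]
  intro η hη
  obtain ⟨δ, hδ, h⟩ := Metric.eventually_nhds_iff.1
    ((ENNReal.tendsto_nhds_zero.1 (tendsto_eLpNorm_translate_sub hw)) η hη)
  filter_upwards [hφ.eventually (gt_mem_nhds hδ)] with m hm
  refine eLpNorm_convolution_normed_sub_le hw _ fun t ht => h ?_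
  exact (Metric.mem_ball.1 ht).trans hm

lemma tendsto_eLpNorm_stdGaussian_of_volume {n : ℕ} {v : ℕ → E n → ℝ}
    (h : Tendsto (fun m => eLpNorm (v m) 2) atTop (𝓝 0)) :
    Tendsto (fun m => eLpNorm (v m) 2 (stdGaussian (E n))) atTop (𝓝 0) := by
  obtain ⟨C, hC, hle⟩ := exists_stdGaussian_le_smul_volume n
  have h1 := ENNReal.Tendsto.const_mul (a := C ^ (1 / (2 : ENNReal)).toReal) h
    (Or.inr (by finiteness))
  rw [mul_zero] at h1
  refine tendsto_of_tendsto_of_tendsto_of_le_of_le tendsto_const_nhds h1 (fun _ => zero_le) fun m => ?_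
  refine (eLpNorm_mono_measure _ hle).trans ?_
  rw [eLpNorm_smul_measure_of_ne_top (by simp), smul_eq_mul]

/-- On the support the Gaussian density is bounded below. After a cutoff, mollification can
therefore be done in Lebesgue `L²`, where translations are isometries. -/
lemma memLp_volume_of_compact {n : ℕ} {w : E n → ℝ} (hw : MemLp w 2 (stdGaussian (E n)))
    (hc : HasCompactSupport w) : MemLp w 2 := by
  obtain ⟨C, hC, hle⟩ := exists_volume_restrict_le_smul_stdGaussian hc.isCompact
  have h1 : MemLp w 2 (volume.restrict (tsupport w)) := hw.of_measure_le_smul hC hle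
  refine ⟨hw.1.mono_ac (volume_absolutelyContinuous_stdGaussian n), ?_⟩
  rw [← eLpNorm_restrict_eq_of_support_subset (subset_tsupport w)]
  exact h1.2

lemma IsSobolev.smooth_mul {n : ℕ} {u χ : E n → ℝ} {g : Fin n → E n → ℝ} (h : IsSobolev u g)
    (hχ : IsTest χ) :
    IsSobolev (fun x => χ x * u x) (fun i x => χ x * g i x + pderiv i χ x * u x) := by
  have hm : ∀ {a b : E n → ℝ}, IsTest a → MemLp b 2 (stdGaussian (E n)) →
      MemLp (fun x => a x * b x) 2 (stdGaussian (E n)) := fun ha hb =>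
    hb.mul (ha.memLp ⊤ _)
  exact ⟨fun i => (h.isWeakPartial i).smooth_mul hχ, hm hχ h.memLp,
    fun i => (hm hχ (h.memLp_partial i)).add (hm (hχ.pderiv i) h.memLp)⟩

lemma eLpNorm_sub_le_add {α : Type*} [MeasurableSpace α] {μ : Measure α} {a b c : α → ℝ}
    (ha : AEStronglyMeasurable a μ) (hb : AEStronglyMeasurable b μ)
    (hc : AEStronglyMeasurable c μ) {p : ENNReal} (hp : 1 ≤ p) :
    eLpNorm (fun x => a x - c x) p μ ≤
      eLpNorm (fun x => a x - b x) p μ + eLpNorm (fun x => b x - c x) p μ := by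
  have : (fun x => a x - c x) = (fun x => a x - b x) + fun x => b x - c x := by
    funext x
    simp
  rw [this]
  exact eLpNorm_add_le (ha.sub hb) (hb.sub hc) hp

/-- Mollification commutes with weak derivatives, so a single sufficiently narrow kernel
approximates `w` and all of its partial derivatives. -/
lemma IsSobolev.exists_test_of_compact {n : ℕ} {w : E n → ℝ} {g : Fin n → E n → ℝ}
    (h : IsSobolev w g) (hw : HasCompactSupport w) (hg : ∀ i, HasCompactSupport (g i))
    {ε : ENNReal} (hε : ε ≠ 0) :
    ∃ v, IsTest v ∧ eLpNorm (fun x => v x - w x) 2 (stdGaussian (E n)) ≤ ε ∧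
      ∀ i, eLpNorm (fun x => pderiv i v x - g i x) 2 (stdGaussian (E n)) ≤ ε := by
  let φ : ℕ → ContDiffBump (0 : E n) := fun m =>
    ⟨1 / (m + 1 : ℝ) / 2, 1 / (m + 1 : ℝ), by positivity, half_lt_self (by positivity)⟩
  have hφ : Tendsto (fun m => (φ m).rOut) atTop (𝓝 0) := tendsto_one_div_add_atTop_nhds_zero_nat
  have key : ∀ {b : E n → ℝ}, MemLp b 2 (stdGaussian (E n)) → HasCompactSupport b →
      ∀ᶠ m in atTop, eLpNorm (fun x => (b ⋆[lsmul ℝ ℝ] (φ m).normed volume) x - b x) 2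
        (stdGaussian (E n)) ≤ ε := fun hb hbc =>
    ENNReal.tendsto_nhds_zero.1 (tendsto_eLpNorm_stdGaussian_of_volume
      (tendsto_eLpNorm_convolution_normed (memLp_volume_of_compact hb hbc) hφ)) ε hε.bot_lt
  obtain ⟨m, hm1, hm2⟩ := ((key h.memLp hw).and
    (eventually_all.2 fun i => key (h.memLp_partial i) (hg i))).exists
  have ht : IsTest ((φ m).normed (volume : Measure (E n))) :=
    ⟨(φ m).contDiff_normed, (φ m).hasCompactSupport_normed⟩
  have hloc : LocallyIntegrable w :=
    (memLp_volume_of_compact h.memLp hw).locallyIntegrable (by norm_num)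
  refine ⟨w ⋆[lsmul ℝ ℝ] (φ m).normed volume,
    ⟨ht.2.contDiff_convolution_right (lsmul ℝ ℝ) hloc ht.1, hw.convolution (lsmul ℝ ℝ) ht.2⟩, hm1,
    fun i => ?_⟩
  simp_rw [(h.isWeakPartial i).pderiv_convolution ht]
  exact hm2 i

/-- Test functions are dense in the Gaussian Sobolev space. -/
lemma IsSobolev.exists_test {n : ℕ} {u : E n → ℝ} {g : Fin n → E n → ℝ}
    (h : IsSobolev u g) {ε : ENNReal} (hε : ε ≠ 0) :
    ∃ v, IsTest v ∧ eLpNorm (fun x => v x - u x) 2 (stdGaussian (E n)) ≤ ε ∧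
      ∀ i, eLpNorm (fun x => pderiv i v x - g i x) 2 (stdGaussian (E n)) ≤ ε := by
  obtain ⟨χ, C, hχ, hχ1, hχlim, hC⟩ := exists_cutoff n
  have hε2 : ε / 2 ≠ 0 := by simpa using hε
  have key : ∀ {b : E n → ℝ}, MemLp b 2 (stdGaussian (E n)) →
      Tendsto (fun m => eLpNorm (fun x => χ m x * b x - b x) 2 (stdGaussian (E n)))
        atTop (𝓝 0) := fun hb =>
    tendsto_eLpNorm_mul_sub hb (fun m => (hχ m).1.continuous.aestronglyMeasurable) hχ1 hχlim
  -- This controls the extra term `(∂ᵢ χ_m) u` that the product rule produces.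
  have hu : Tendsto (fun m : ℕ => ENNReal.ofReal (C / (m + 1)) *
      eLpNorm u 2 (stdGaussian (E n))) atTop (𝓝 0) := by
    have h1 : Tendsto (fun m : ℕ => C / (m + 1 : ℝ)) atTop (𝓝 0) := by
      simpa [div_eq_mul_inv] using
        tendsto_one_div_add_atTop_nhds_zero_nat.const_mul C
    have h2 := ENNReal.tendsto_ofReal h1
    rw [ENNReal.ofReal_zero] at h2
    simpa using ENNReal.Tendsto.mul_const h2 (Or.inr h.memLp.2.ne)
  have hgr : ∀ i, Tendsto (fun m => eLpNorm
      (fun x => (χ m x * g i x + pderiv i (χ m) x * u x) - g i x) 2 (stdGaussian (E n)))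
      atTop (𝓝 0) := by
    intro i
    have h1 := (key (h.memLp_partial i)).add hu
    rw [add_zero] at h1
    refine tendsto_of_tendsto_of_tendsto_of_le_of_le tendsto_const_nhds h1 (fun _ => zero_le)
      fun m => ?_
    have heq : (fun x => (χ m x * g i x + pderiv i (χ m) x * u x) - g i x) =
        (fun x => χ m x * g i x - g i x) + fun x => pderiv i (χ m) x * u x := by
      funext x
      simp
      ring
    have hcm : AEStronglyMeasurable (χ m) (stdGaussian (E n)) :=
      (hχ m).1.continuous.aestronglyMeasurable
    have hcd : AEStronglyMeasurable (pderiv i (χ m)) (stdGaussian (E n)) :=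
      ((hχ m).pderiv i).1.continuous.aestronglyMeasurable
    rw [heq]
    refine (eLpNorm_add_le ((hcm.mul (h.memLp_partial i).1).sub (h.memLp_partial i).1)
      (hcd.mul h.memLp.1) (by norm_num)).trans ?_
    refine add_le_add le_rfl ?_
    refine eLpNorm_le_mul_eLpNorm_of_ae_le_mul (f := fun x => pderiv i (χ m) x * u x) (g := u)
      (ae_of_all _ fun x => ?_) 2
    rw [norm_mul]
    exact mul_le_mul_of_nonneg_right (hC m i x) (norm_nonneg _)
  -- Half of `ε` is spent on the cutoff and half on mollifying the truncated function.
  obtain ⟨m, hm1, hm2⟩ := ((ENNReal.tendsto_nhds_zero.1 (key h.memLp) _ hε2.bot_lt).and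
    (eventually_all.2 fun i => ENNReal.tendsto_nhds_zero.1 (hgr i) _ hε2.bot_lt)).exists
  have hS := h.smooth_mul (hχ m)
  obtain ⟨v, hv, hv1, hv2⟩ := hS.exists_test_of_compact (hχ m).2.mul_right
    (fun i => (hχ m).2.mul_right.add ((hχ m).pderiv i).2.mul_right) hε2
  refine ⟨v, hv, ?_, fun i => ?_⟩
  · refine (eLpNorm_sub_le_add hv.1.continuous.aestronglyMeasurable hS.memLp.1 h.memLp.1
      (by norm_num)).trans ((add_le_add hv1 hm1).trans (ENNReal.add_halves ε).le)
  · refine (eLpNorm_sub_le_add (hv.pderiv i).1.continuous.aestronglyMeasurable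
      (hS.memLp_partial i).1 (h.memLp_partial i).1
      (by norm_num)).trans ((add_le_add (hv2 i) (hm2 i)).trans (ENNReal.add_halves ε).le)

lemma IsSobolev.exists_test_seq {n : ℕ} {u : E n → ℝ} {g : Fin n → E n → ℝ}
    (h : IsSobolev u g) :
    ∃ v : ℕ → E n → ℝ, (∀ m, IsTest (v m)) ∧
      Tendsto (fun m => eLpNorm (fun x => v m x - u x) 2 (stdGaussian (E n))) atTop (𝓝 0) ∧
      ∀ i, Tendsto (fun m => eLpNorm (fun x => pderiv i (v m) x - g i x) 2 (stdGaussian (E n)))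
        atTop (𝓝 0) := by
  have hpos : ∀ m : ℕ, ((m : ENNReal) + 1)⁻¹ ≠ 0 := fun m => by simp
  choose v hv h1 h2 using fun m => h.exists_test (hpos m)
  have hlim : Tendsto (fun m : ℕ => ((m : ENNReal) + 1)⁻¹) atTop (𝓝 0) := by
    have := ENNReal.tendsto_inv_nat_nhds_zero.comp (tendsto_add_atTop_nat 1)
    simpa [Function.comp_def] using this
  exact ⟨v, hv,
    tendsto_of_tendsto_of_tendsto_of_le_of_le tendsto_const_nhds hlim (fun _ => zero_le) h1,
    fun i => tendsto_of_tendsto_of_tendsto_of_le_of_le tendsto_const_nhds hlim (fun _ => zero_le)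
      fun m => h2 m i⟩

end QuadApprox

namespace QuadApprox

/-! ### The isometry for the divergence operator -/

section L2

variable {α : Type*} [MeasurableSpace α] {μ : Measure α}

lemma tendsto_toLp_of_eLpNorm {a : ℕ → α → ℝ} {b : α → ℝ} (ha : ∀ m, MemLp (a m) 2 μ)
    (hb : MemLp b 2 μ) (h : Tendsto (fun m => eLpNorm (fun x => a m x - b x) 2 μ) atTop (𝓝 0)) :
    Tendsto (fun m => (ha m).toLp (a m)) atTop (𝓝 (hb.toLp b)) :=
  (Lp.tendsto_Lp_iff_tendsto_eLpNorm'' a ha b hb).2 h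

lemma inner_toLp {a b : α → ℝ} (ha : MemLp a 2 μ) (hb : MemLp b 2 μ) :
    inner ℝ (ha.toLp a) (hb.toLp b) = ∫ x, a x * b x ∂μ := by
  rw [L2.inner_def]
  refine integral_congr_ae ?_
  filter_upwards [ha.coeFn_toLp, hb.coeFn_toLp] with x h1 h2
  simp [h1, h2, mul_comm]

lemma norm_toLp_sq {a : α → ℝ} (ha : MemLp a 2 μ) :
    ‖ha.toLp a‖ ^ 2 = ∫ x, a x ^ 2 ∂μ := by
  rw [← real_inner_self_eq_norm_sq, inner_toLp ha ha]
  simp_rw [sq]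

lemma tendsto_integral_mul {a b : ℕ → α → ℝ} {a' b' : α → ℝ} (ha : ∀ m, MemLp (a m) 2 μ)
    (ha' : MemLp a' 2 μ) (hb : ∀ m, MemLp (b m) 2 μ) (hb' : MemLp b' 2 μ)
    (h1 : Tendsto (fun m => eLpNorm (fun x => a m x - a' x) 2 μ) atTop (𝓝 0))
    (h2 : Tendsto (fun m => eLpNorm (fun x => b m x - b' x) 2 μ) atTop (𝓝 0)) :
    Tendsto (fun m => ∫ x, a m x * b m x ∂μ) atTop (𝓝 (∫ x, a' x * b' x ∂μ)) := by
  simp_rw [← inner_toLp (ha _) (hb _), ← inner_toLp ha' hb']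
  exact (tendsto_toLp_of_eLpNorm ha ha' h1).inner (tendsto_toLp_of_eLpNorm hb hb' h2)

lemma tendsto_integral_of_eLpNorm [IsProbabilityMeasure μ] {a : ℕ → α → ℝ} {a' : α → ℝ}
    (ha : ∀ m, MemLp (a m) 2 μ) (ha' : MemLp a' 2 μ)
    (h1 : Tendsto (fun m => eLpNorm (fun x => a m x - a' x) 2 μ) atTop (𝓝 0)) :
    Tendsto (fun m => ∫ x, a m x ∂μ) atTop (𝓝 (∫ x, a' x ∂μ)) := by
  have := tendsto_integral_mul (b := fun _ _ => 1) (b' := fun _ => 1) ha ha'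
    (fun _ => memLp_const _) (memLp_const _) h1 (by simp)
  simpa using this

end L2

variable {n : ℕ}

lemma memLp_coord (i : Fin n) (p : ENNReal) (hp : p ≠ ⊤) :
    MemLp (fun x : E n => x i) p (stdGaussian (E n)) := by
  have hid : MemLp (id : E n → E n) p (stdGaussian (E n)) := IsGaussian.memLp_id _ p hp
  exact (EuclideanSpace.proj (𝕜 := ℝ) i).comp_memLp' hid

/-- Gaussian integration by parts against a test function. -/
lemma IsWeakPartial.integral_mul_coord_sub {u g ψ : E n → ℝ} {i : Fin n}
    (h : IsWeakPartial u i g) (hψ : IsTest ψ) :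
    ∫ x, u x * (x i * ψ x - pderiv i ψ x) ∂(stdGaussian (E n)) =
      ∫ x, g x * ψ x ∂(stdGaussian (E n)) := by
  rw [integral_stdGaussian_eq, integral_stdGaussian_eq]
  -- Testing against `ψ` times the density makes its logarithmic derivative supply the factor `xᵢ`.
  have ht : IsTest fun x => ψ x * gaussianDensity x := hψ.mul_right contDiff_gaussianDensity
  have h1 := h.2.2 _ ht.1 ht.2
  have h2 : ∀ x, u x * (x i * ψ x - pderiv i ψ x) * gaussianDensity x =
      -(u x * fderiv ℝ (fun x => ψ x * gaussianDensity x) x (EuclideanSpace.single i 1)) := by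
    intro x
    have := pderiv_mul hψ.1 contDiff_gaussianDensity i x
    simp only [pderiv, fderiv_gaussianDensity] at this ⊢
    rw [this, show inner ℝ x (EuclideanSpace.single i (1 : ℝ)) = x i by
      simp [EuclideanSpace.inner_single_right]]
    ring
  simp_rw [h2]
  rw [integral_neg, h1, neg_neg]
  simp_rw [mul_assoc]

lemma isTest_creation {v : E n → ℝ} (hv : IsTest v) (i : Fin n) :
    IsTest fun x => x i * v x - pderiv i v x :=
  (IsTest.mul (contDiff_coord i) hv).sub (hv.pderiv i)

lemma integral_creation_test {u : E n → ℝ} (hu : IsTest u) (i : Fin n) :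
    ∫ x, (x i * u x - pderiv i u x) ∂(stdGaussian (E n)) = 0 := by
  have h := (isWeakPartial_of_contDiff (u := fun _ : E n => (1 : ℝ))
    contDiff_const i).integral_mul_coord_sub hu
  simpa using h

/-- Integrate by parts once to move `xᵢ - ∂ᵢ` off `u` as a derivative of the other factor, use the
commutation relation `[∂ᵢ, xⱼ - ∂ⱼ] = δᵢⱼ`, and integrate by parts again to move `xⱼ - ∂ⱼ` onto `u`.
-/
lemma integral_creation_mul_creation_test {u v : E n → ℝ} (hu : IsTest u) (hv : IsTest v)
    (i j : Fin n) :
    ∫ x, (x i * u x - pderiv i u x) * (x j * v x - pderiv j v x) ∂(stdGaussian (E n)) =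
      (if i = j then ∫ x, u x * v x ∂(stdGaussian (E n)) else 0) +
        ∫ x, pderiv j u x * pderiv i v x ∂(stdGaussian (E n)) := by
  have ht := isTest_creation hv j
  have h1 := (isWeakPartial_of_contDiff ht.1 i).integral_mul_coord_sub hu
  have h2 := (isWeakPartial_of_contDiff hu.1 j).integral_mul_coord_sub (hv.pderiv i)
  have h3 : ∀ x, pderiv i (fun x => x j * v x - pderiv j v x) x * u x =
      (if i = j then u x * v x else 0) +
        u x * (x j * pderiv i v x - pderiv j (pderiv i v) x) := by
    intro x
    rw [pderiv_sub ((contDiff_coord j).mul hv.1) (contDiff_pderiv hv.1 j),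
      pderiv_mul (contDiff_coord j) hv.1, pderiv_coord, pderiv_comm hv.1 i j]
    by_cases hij : i = j
    · simp [hij]; ring
    · simp [hij, Ne.symm hij]; ring
  simp_rw [h3] at h1
  have i1 : Integrable (fun x => if i = j then u x * v x else 0) (stdGaussian (E n)) := by
    split_ifs
    · exact (IsTest.mul hu.1 hv).integrable _
    · exact integrable_zero _ _ _
  have i2 : Integrable (fun x => u x * (x j * pderiv i v x - pderiv j (pderiv i v) x))
      (stdGaussian (E n)) :=
    (IsTest.mul hu.1 (isTest_creation (hv.pderiv i) j)).integrable _
  rw [integral_add i1 i2, h2] at h1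
  simp_rw [mul_comm (_ * u _ - _)]
  rw [h1]
  split_ifs <;> simp

lemma memLp_one_coord_mul {u : E n → ℝ} (hu : MemLp u 2 (stdGaussian (E n))) (i : Fin n) :
    MemLp (fun x => x i * u x) 1 (stdGaussian (E n)) :=
  hu.mul (memLp_coord i 2 (by simp))

/-- The isometry for `u - v` with `j = i` expresses the squared left side as a sum of two squares,
at most the square of the sum. It makes `u ↦ xᵢ u - ∂ᵢ u` continuous for the Sobolev norm. -/
lemma norm_toLp_creation_sub_le {u v : E n → ℝ} (hu : IsTest u) (hv : IsTest v) (i : Fin n) :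
    dist (((isTest_creation hu i).memLp 2 (stdGaussian (E n))).toLp _)
        (((isTest_creation hv i).memLp 2 (stdGaussian (E n))).toLp _) ≤
      dist ((hu.memLp 2 (stdGaussian (E n))).toLp u) ((hv.memLp 2 (stdGaussian (E n))).toLp v) +
        dist (((hu.pderiv i).memLp 2 (stdGaussian (E n))).toLp _)
          (((hv.pderiv i).memLp 2 (stdGaussian (E n))).toLp _) := by
  have hs := hu.sub hv
  have hc : (fun x => x i * (u x - v x) - pderiv i (fun x => u x - v x) x) =
      (fun x => x i * u x - pderiv i u x) - fun x => x i * v x - pderiv i v x := by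
    funext x
    rw [pderiv_sub hu.1 hv.1]
    simp only [Pi.sub_apply]
    ring
  have hp : pderiv i (fun x => u x - v x) = pderiv i u - pderiv i v := by
    funext x
    rw [pderiv_sub hu.1 hv.1]
    rfl
  have h0 := integral_creation_mul_creation_test hs hs i i
  simp only [if_true, ← sq] at h0
  rw [← norm_toLp_sq ((isTest_creation hs i).memLp 2 _), ← norm_toLp_sq (hs.memLp 2 _),
    ← norm_toLp_sq ((hs.pderiv i).memLp 2 _)] at h0
  simp only [dist_eq_norm, ← MemLp.toLp_sub]
  simp only [hc] at h0
  simp only [hp] at h0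
  refine abs_le_of_sq_le_sq' ?_ (by positivity) |>.2
  rw [h0, add_sq]
  have : 0 ≤ 2 * ‖(((hu.memLp 2 (stdGaussian (E n))).sub (hv.memLp 2 (stdGaussian (E n)))).toLp
    (u - v))‖ * ‖((((hu.pderiv i).memLp 2 (stdGaussian (E n))).sub
      ((hv.pderiv i).memLp 2 (stdGaussian (E n)))).toLp (pderiv i u - pderiv i v))‖ := by positivity
  have e : (fun x => u x - v x) = u - v := rfl
  simp only [e]
  linarith

/-- Approximation of a Gaussian Sobolev function by test functions, together with its partial
derivatives and the functions `xᵢ u - ∂ᵢ u`. -/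
lemma IsSobolev.exists_test_seq_creation {u : E n → ℝ} {g : Fin n → E n → ℝ} (h : IsSobolev u g) :
    (∀ i, MemLp (fun x => x i * u x - g i x) 2 (stdGaussian (E n))) ∧
    ∃ v : ℕ → E n → ℝ, (∀ m, IsTest (v m)) ∧
      Tendsto (fun m => eLpNorm (fun x => v m x - u x) 2 (stdGaussian (E n))) atTop (𝓝 0) ∧
      (∀ i, Tendsto (fun m => eLpNorm (fun x => pderiv i (v m) x - g i x) 2 (stdGaussian (E n)))
        atTop (𝓝 0)) ∧
      ∀ i, Tendsto (fun m => eLpNorm (fun x => (x i * v m x - pderiv i (v m) x) -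
        (x i * u x - g i x)) 2 (stdGaussian (E n))) atTop (𝓝 0) := by
  obtain ⟨v, hv, hvu, hvg⟩ := h.exists_test_seq
  have main : ∀ i, MemLp (fun x => x i * u x - g i x) 2 (stdGaussian (E n)) ∧
      Tendsto (fun m => eLpNorm (fun x => (x i * v m x - pderiv i (v m) x) -
        (x i * u x - g i x)) 2 (stdGaussian (E n))) atTop (𝓝 0) := by
    intro i
    have c1 := (tendsto_toLp_of_eLpNorm (fun m => (hv m).memLp 2 _) h.memLp hvu).cauchySeq
    have c2 := (tendsto_toLp_of_eLpNorm (fun m => ((hv m).pderiv i).memLp 2 _)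
      (h.memLp_partial i) (hvg i)).cauchySeq
    have c3 : CauchySeq fun m =>
        (((isTest_creation (hv m) i).memLp 2 (stdGaussian (E n))).toLp _) := by
      rw [cauchySeq_iff_tendsto_dist_atTop_0] at c1 c2 ⊢
      have := c1.add c2
      rw [add_zero] at this
      exact squeeze_zero (fun _ => dist_nonneg)
        (fun p => norm_toLp_creation_sub_le (hv p.1) (hv p.2) i) this
    obtain ⟨W, hW⟩ := cauchySeq_tendsto_of_complete c3
    have hWm : MemLp W 2 (stdGaussian (E n)) := Lp.memLp W
    have hW2 : Tendsto (fun m => eLpNorm ((fun x => x i * v m x - pderiv i (v m) x) - ⇑W) 2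
        (stdGaussian (E n))) atTop (𝓝 0) := by
      rw [← Lp.toLp_coeFn W hWm] at hW
      exact (Lp.tendsto_Lp_iff_tendsto_eLpNorm'' _
        (fun m => (isTest_creation (hv m) i).memLp 2 (stdGaussian (E n))) _ hWm).1 hW
    have hmv : ∀ m, AEStronglyMeasurable (fun x => x i * v m x - pderiv i (v m) x)
        (stdGaussian (E n)) := fun m => (isTest_creation (hv m) i).1.continuous.aestronglyMeasurable
    have hmu : AEStronglyMeasurable (fun x => x i * u x - g i x) (stdGaussian (E n)) :=
      (memLp_one_coord_mul h.memLp i).1.sub (h.memLp_partial i).1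
    -- At this stage `xᵢ u` is only known to be in `L¹`, by Hölder. The `L¹` limit identifies the
    -- abstract `L²` limit `W`, since limits in measure are unique almost everywhere.
    have hL1 : Tendsto (fun m => eLpNorm ((fun x => x i * v m x - pderiv i (v m) x) -
        fun x => x i * u x - g i x) 1 (stdGaussian (E n))) atTop (𝓝 0) := by
      have hb := (ENNReal.Tendsto.const_mul (a := eLpNorm (fun x : E n => x i) 2
        (stdGaussian (E n))) hvu (Or.inr (memLp_coord i 2 (by simp)).2.ne)).add (hvg i)
      rw [mul_zero, add_zero] at hb
      refine tendsto_of_tendsto_of_tendsto_of_le_of_le tendsto_const_nhds hb (fun _ => zero_le)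
        fun m => ?_
      have he : ((fun x => x i * v m x - pderiv i (v m) x) - fun x => x i * u x - g i x) =
          (fun x : E n => x i) • (fun x => v m x - u x) - fun x => pderiv i (v m) x - g i x := by
        funext x
        simp
        ring
      have hm1 := ((hv m).1.continuous.aestronglyMeasurable (μ := stdGaussian (E n))).sub h.memLp.1
      have hm2 := (((hv m).pderiv i).1.continuous.aestronglyMeasurable
        (μ := stdGaussian (E n))).sub (h.memLp_partial i).1
      have hm3 := (memLp_coord (n := n) i 2 (by simp)).1
      rw [he]
      refine (eLpNorm_sub_le (hm3.smul hm1) hm2 le_rfl).trans (add_le_add ?_ ?_)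
      · exact eLpNorm_smul_le_mul_eLpNorm hm1 hm3
      · exact eLpNorm_le_eLpNorm_of_exponent_le (by norm_num) hm2
    have hae := tendstoInMeasure_ae_unique
      (tendstoInMeasure_of_tendsto_eLpNorm one_ne_zero hmv hmu hL1)
      (tendstoInMeasure_of_tendsto_eLpNorm two_ne_zero hmv hWm.1 hW2)
    refine ⟨hWm.ae_eq hae.symm, hW2.congr fun m => eLpNorm_congr_ae ?_⟩
    filter_upwards [hae] with x hx
    simp only [Pi.sub_apply]
    rw [hx]
  exact ⟨fun i => (main i).1, v, hv, hvu, hvg, fun i => (main i).2⟩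

lemma IsSobolev.memLp_creation {u : E n → ℝ} {g : Fin n → E n → ℝ} (h : IsSobolev u g)
    (i : Fin n) : MemLp (fun x => x i * u x - g i x) 2 (stdGaussian (E n)) :=
  h.exists_test_seq_creation.1 i

lemma IsSobolev.integral_creation {u : E n → ℝ} {g : Fin n → E n → ℝ} (h : IsSobolev u g)
    (i : Fin n) : ∫ x, (x i * u x - g i x) ∂(stdGaussian (E n)) = 0 := by
  obtain ⟨hm, v, hv, -, -, hc⟩ := h.exists_test_seq_creation
  have := tendsto_integral_of_eLpNorm (fun m => (isTest_creation (hv m) i).memLp 2 _) (hm i) (hc i)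
  simp_rw [integral_creation_test (hv _) i] at this
  exact tendsto_nhds_unique this tendsto_const_nhds

/-- The isometry for the divergence operator, in scalar form. -/
lemma IsSobolev.integral_creation_mul_creation {u v : E n → ℝ} {g h : Fin n → E n → ℝ}
    (hu : IsSobolev u g) (hv : IsSobolev v h) (i j : Fin n) :
    ∫ x, (x i * u x - g i x) * (x j * v x - h j x) ∂(stdGaussian (E n)) =
      (if i = j then ∫ x, u x * v x ∂(stdGaussian (E n)) else 0) +
        ∫ x, g j x * h i x ∂(stdGaussian (E n)) := by
  obtain ⟨hm, a, ha, hau, hag, hac⟩ := hu.exists_test_seq_creation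
  obtain ⟨hm', b, hb, hbv, hbh, hbc⟩ := hv.exists_test_seq_creation
  have t1 := tendsto_integral_mul (fun m => (isTest_creation (ha m) i).memLp 2 _) (hm i)
    (fun m => (isTest_creation (hb m) j).memLp 2 _) (hm' j) (hac i) (hbc j)
  have t2 := tendsto_integral_mul (fun m => (ha m).memLp 2 _) hu.memLp
    (fun m => (hb m).memLp 2 _) hv.memLp hau hbv
  have t3 := tendsto_integral_mul (fun m => ((ha m).pderiv j).memLp 2 _) (hu.memLp_partial j)
    (fun m => ((hb m).pderiv i).memLp 2 _) (hv.memLp_partial i) (hag j) (hbh i)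
  simp_rw [integral_creation_mul_creation_test (ha _) (hb _) i j] at t1
  refine tendsto_nhds_unique t1 (Tendsto.add ?_ t3)
  split_ifs
  · exact t2
  · exact tendsto_const_nhds

end QuadApprox

namespace QuadApprox

/-! ### The Gaussian Poincaré inequality -/

variable {n : ℕ}

/-- Independence multiplies the characteristic functions, and the quadratic exponents add up by `c²
+ s² = 1`. -/
lemma map_stdGaussian_prod {c s : ℝ} (h : c ^ 2 + s ^ 2 = 1) :
    ((stdGaussian (E n)).prod (stdGaussian (E n))).map
      (fun p : E n × E n => c • p.1 + s • p.2) = stdGaussian (E n) := by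
  have hcomp : (fun p : E n × E n => c • p.1 + s • p.2) =
      (fun p : E n × E n => p.1 + p.2) ∘ Prod.map (c • ·) (s • ·) := rfl
  have hm : Measurable (Prod.map (c • ·) (s • ·) : E n × E n → E n × E n) :=
    (measurable_const_smul c).prodMap (measurable_const_smul s)
  have : IsProbabilityMeasure ((stdGaussian (E n)).map (c • ·)) :=
    Measure.isProbabilityMeasure_map (measurable_const_smul c).aemeasurable
  have : IsProbabilityMeasure ((stdGaussian (E n)).map (s • ·)) :=
    Measure.isProbabilityMeasure_map (measurable_const_smul s).aemeasurable
  rw [hcomp, ← Measure.map_map (by fun_prop) hm,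
    ← Measure.map_prod_map _ _ (measurable_const_smul c) (measurable_const_smul s)]
  refine Measure.ext_of_charFun ?_
  ext t
  rw [charFun_map_add_prod_eq_mul, Pi.mul_apply, charFun_map_smul, charFun_map_smul,
    charFun_stdGaussian, charFun_stdGaussian, charFun_stdGaussian, ← Complex.exp_add]
  congr 1
  rw [norm_smul, norm_smul]
  simp only [Real.norm_eq_abs]
  have h2 : ((|c| : ℝ) : ℂ) ^ 2 + ((|s| : ℝ) : ℂ) ^ 2 = 1 := by
    rw [← Complex.ofReal_pow, ← Complex.ofReal_pow, sq_abs, sq_abs]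
    exact_mod_cast h
  push_cast
  linear_combination (-(‖t‖ : ℂ) ^ 2 / 2) * h2

lemma IsTest.exists_bound {u : E n → ℝ} (hu : IsTest u) : ∃ C, ∀ x, ‖u x‖ ≤ C :=
  hu.2.exists_bound_of_continuous hu.1.continuous

lemma IsTest.integrable_mul_comp_rotation {a b : E n → ℝ} (ha : IsTest a) (hb : IsTest b) (c s : ℝ) :
    Integrable (fun p : E n × E n => a p.1 * b (c • p.1 + s • p.2))
      ((stdGaussian (E n)).prod (stdGaussian (E n))) := by
  obtain ⟨A, hA⟩ := ha.exists_bound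
  obtain ⟨B, hB⟩ := hb.exists_bound
  have hca := ha.1.continuous
  have hcb := hb.1.continuous
  refine Integrable.of_bound (Continuous.aestronglyMeasurable (by fun_prop)) (A * B)
    (ae_of_all _ fun p => ?_)
  rw [norm_mul]
  exact mul_le_mul (hA _) (hB _) (norm_nonneg _) ((norm_nonneg _).trans (hA p.1))

lemma IsTest.integrable_snd_mul_comp_rotation {a b : E n → ℝ} (ha : IsTest a) (hb : IsTest b)
    (c s : ℝ) (i : Fin n) :
    Integrable (fun p : E n × E n => p.2 i * (a p.1 * b (c • p.1 + s • p.2)))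
      ((stdGaussian (E n)).prod (stdGaussian (E n))) := by
  obtain ⟨A, hA⟩ := ha.exists_bound
  obtain ⟨B, hB⟩ := hb.exists_bound
  have hca := ha.1.continuous
  have hcb := hb.1.continuous
  have hi : Integrable (fun p : E n × E n => p.2 i)
      ((stdGaussian (E n)).prod (stdGaussian (E n))) :=
    ((memLp_coord i 1 (by simp)).integrable le_rfl).comp_snd _
  refine hi.mul_bdd (c := A * B) (Continuous.aestronglyMeasurable (by fun_prop))
    (ae_of_all _ fun p => ?_)
  rw [norm_mul]
  exact mul_le_mul (hA _) (hB _) (norm_nonneg _) ((norm_nonneg _).trans (hA p.1))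

lemma IsTest.comp_affine {b : E n → ℝ} (hb : IsTest b) {s : ℝ} (hs : s ≠ 0) (w : E n) :
    IsTest fun y => b (w + s • y) :=
  ⟨hb.1.comp (contDiff_const.add (contDiff_const_smul s)),
    hb.2.comp_homeomorph ((Homeomorph.smulOfNeZero s hs).trans (Homeomorph.addLeft w))⟩

lemma pderiv_comp_affine {b : E n → ℝ} (hb : ContDiff ℝ (⊤ : ℕ∞) b) (s : ℝ) (w y : E n)
    (i : Fin n) : pderiv i (fun y => b (w + s • y)) y = s * pderiv i b (w + s • y) := by
  have h := ((differentiable_of_smooth hb (w + s • y)).hasFDerivAt).comp y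
    (((hasFDerivAt_id y).const_smul s).const_add w)
  have h' := h.fderiv
  simp only [Function.comp_def] at h'
  unfold pderiv
  have e : (fun y => b (w + s • y)) = fun x => b (w + (s • id) x) := rfl
  rw [e, h']
  simp

/-- Integration by parts in the second variable. -/
lemma integral_snd_mul_comp_rotation {a b : E n → ℝ} (ha : IsTest a) (hb : IsTest b) {c s : ℝ}
    (hs : s ≠ 0) (i : Fin n) :
    ∫ p, p.2 i * (a p.1 * b (c • p.1 + s • p.2))
        ∂((stdGaussian (E n)).prod (stdGaussian (E n))) =
      s * ∫ p, a p.1 * pderiv i b (c • p.1 + s • p.2)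
        ∂((stdGaussian (E n)).prod (stdGaussian (E n))) := by
  rw [integral_prod _ (ha.integrable_snd_mul_comp_rotation hb c s i),
    integral_prod _ (ha.integrable_mul_comp_rotation (hb.pderiv i) c s), ← integral_const_mul]
  refine integral_congr_ae (ae_of_all _ fun x => ?_)
  simp only
  have ht := hb.comp_affine hs (c • x)
  have h := integral_creation_test ht i
  rw [integral_sub ((IsTest.mul (contDiff_coord i) ht).integrable _)
    ((ht.pderiv i).integrable _), sub_eq_zero] at h
  simp_rw [pderiv_comp_affine hb.1, integral_const_mul] at h
  simp_rw [mul_left_comm _ (a x), integral_const_mul, h]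
  ring

/-- Integration by parts in the first variable. -/
lemma integral_fst_mul_comp_rotation {a b : E n → ℝ} (ha : IsTest a) (hb : IsTest b) (c s : ℝ)
    (i : Fin n) :
    ∫ p, (p.1 i * a p.1) * b (c • p.1 + s • p.2)
        ∂((stdGaussian (E n)).prod (stdGaussian (E n))) =
      (∫ p, pderiv i a p.1 * b (c • p.1 + s • p.2)
        ∂((stdGaussian (E n)).prod (stdGaussian (E n)))) +
      c * ∫ p, a p.1 * pderiv i b (c • p.1 + s • p.2)
        ∂((stdGaussian (E n)).prod (stdGaussian (E n))) := by
  have i1 := (IsTest.mul (contDiff_coord i) ha).integrable_mul_comp_rotation hb c s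
  have i2 := (ha.pderiv i).integrable_mul_comp_rotation hb c s
  have i3 := (ha.integrable_mul_comp_rotation (hb.pderiv i) c s).const_mul c
  have i4 : Integrable (fun p : E n × E n => pderiv i a p.1 * b (c • p.1 + s • p.2) +
      c * (a p.1 * pderiv i b (c • p.1 + s • p.2)))
      ((stdGaussian (E n)).prod (stdGaussian (E n))) := i2.add i3
  rw [← integral_const_mul, ← integral_add i2 i3, integral_prod_symm _ i1,
    integral_prod_symm _ i4]
  refine integral_congr_ae (ae_of_all _ fun y => ?_)
  simp only
  have hbs : ContDiff ℝ (⊤ : ℕ∞) fun x => b (s • y + c • x) :=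
    hb.1.comp (contDiff_const.add (contDiff_const_smul c))
  have ht : IsTest fun x => a x * b (s • y + c • x) := ha.mul_right hbs
  have h := integral_creation_test ht i
  rw [integral_sub ((IsTest.mul (contDiff_coord i) ht).integrable _)
    ((ht.pderiv i).integrable _), sub_eq_zero] at h
  simp_rw [pderiv_mul ha.1 hbs, pderiv_comp_affine hb.1] at h
  simp_rw [add_comm (c • _) (s • y), mul_assoc, h]
  exact integral_congr_ae (ae_of_all _ fun x => by ring)

lemma fderiv_eq_sum_pderiv (u : E n → ℝ) (x v : E n) :
    fderiv ℝ u x v = ∑ i, v i * pderiv i u x := by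
  have hv : v = ∑ i, v i • EuclideanSpace.single i (1 : ℝ) := by
    simpa using ((EuclideanSpace.basisFun (Fin n) ℝ).sum_repr v).symm
  conv_lhs => rw [hv]
  simp [pderiv, map_sum]

/-- The derivative of `θ ↦ E[u(X) u(X cos θ + Y sin θ)]`. -/
lemma hasDerivAt_integral_rotation {u : E n → ℝ} (hu : IsTest u) (θ : ℝ) :
    HasDerivAt (fun θ : ℝ => ∫ p, u p.1 * u (Real.cos θ • p.1 + Real.sin θ • p.2)
        ∂((stdGaussian (E n)).prod (stdGaussian (E n))))
      (∫ p, u p.1 * ∑ i, (-Real.sin θ * p.1 i + Real.cos θ * p.2 i) *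
        pderiv i u (Real.cos θ • p.1 + Real.sin θ • p.2)
        ∂((stdGaussian (E n)).prod (stdGaussian (E n)))) θ := by
  obtain ⟨A, hA⟩ := hu.exists_bound
  choose B hB using fun i => (hu.pderiv i).exists_bound
  have hA0 : 0 ≤ A := (norm_nonneg _).trans (hA 0)
  have hcu := hu.1.continuous
  have hcp : ∀ i, Continuous (pderiv i u) := fun i => (hu.pderiv i).1.continuous
  have hi1 : ∀ i : Fin n, Integrable (fun p : E n × E n => |p.1 i|)
      ((stdGaussian (E n)).prod (stdGaussian (E n))) := fun i =>
    ((memLp_coord i 1 (by simp)).integrable le_rfl).abs.comp_fst _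
  have hi2 : ∀ i : Fin n, Integrable (fun p : E n × E n => |p.2 i|)
      ((stdGaussian (E n)).prod (stdGaussian (E n))) := fun i =>
    ((memLp_coord i 1 (by simp)).integrable le_rfl).abs.comp_snd _
  refine (hasDerivAt_integral_of_dominated_loc_of_deriv_le (s := Set.univ) univ_mem
    (F' := fun θ p => u p.1 * ∑ i, (-Real.sin θ * p.1 i + Real.cos θ * p.2 i) *
        pderiv i u (Real.cos θ • p.1 + Real.sin θ • p.2))
    (bound := fun p => A * ∑ i, (|p.1 i| + |p.2 i|) * B i)
    (Eventually.of_forall fun θ => (hu.integrable_mul_comp_rotation hu _ _).1)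
    (hu.integrable_mul_comp_rotation hu _ _)
    (Continuous.aestronglyMeasurable (by fun_prop)) (ae_of_all _ fun p θ _ => ?_)
    ((integrable_finsetSum _ fun i _ => ((hi1 i).add (hi2 i)).mul_const _).const_mul _)
    (ae_of_all _ fun p θ _ => ?_)).2
  · rw [norm_mul]
    refine mul_le_mul (hA _) ((norm_sum_le _ _).trans (Finset.sum_le_sum fun i _ => ?_))
      (norm_nonneg _) hA0
    rw [norm_mul]
    refine mul_le_mul ?_ (hB i _) (norm_nonneg _) (by positivity)
    refine (norm_add_le _ _).trans (add_le_add ?_ ?_)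
    · rw [norm_mul, norm_neg]
      exact mul_le_of_le_one_left (norm_nonneg _) (Real.abs_sin_le_one θ)
    · rw [norm_mul]
      exact mul_le_of_le_one_left (norm_nonneg _) (Real.abs_cos_le_one θ)
  · refine HasDerivAt.const_mul _ ?_
    have h1 : HasDerivAt (fun θ : ℝ => Real.cos θ • p.1 + Real.sin θ • p.2)
        (-Real.sin θ • p.1 + Real.cos θ • p.2) θ :=
      ((Real.hasDerivAt_cos θ).smul_const p.1).add ((Real.hasDerivAt_sin θ).smul_const p.2)
    have h2 := (differentiable_of_smooth hu.1 _).hasFDerivAt.comp_hasDerivAt θ h1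
    rw [fderiv_eq_sum_pderiv] at h2
    simpa [Function.comp_def] using h2

/-- Integrating by parts in both variables, the second-derivative terms carry the factors `-sin θ
cos θ` and `cos θ sin θ` and cancel. For `sin θ = 0` the rotated function no longer depends on the
second variable, hence is not a test function of it. -/
lemma integral_deriv_rotation {u : E n → ℝ} (hu : IsTest u) {θ : ℝ} (hs : Real.sin θ ≠ 0) :
    ∫ p, u p.1 * ∑ i, (-Real.sin θ * p.1 i + Real.cos θ * p.2 i) *
        pderiv i u (Real.cos θ • p.1 + Real.sin θ • p.2)
        ∂((stdGaussian (E n)).prod (stdGaussian (E n))) =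
      -Real.sin θ * ∑ i, ∫ p, pderiv i u p.1 * pderiv i u (Real.cos θ • p.1 + Real.sin θ • p.2)
        ∂((stdGaussian (E n)).prod (stdGaussian (E n))) := by
  have h1 : ∀ p : E n × E n, u p.1 * ∑ i, (-Real.sin θ * p.1 i + Real.cos θ * p.2 i) *
      pderiv i u (Real.cos θ • p.1 + Real.sin θ • p.2) =
      ∑ i, (-Real.sin θ * ((p.1 i * u p.1) * pderiv i u (Real.cos θ • p.1 + Real.sin θ • p.2)) +
        Real.cos θ * (p.2 i * (u p.1 * pderiv i u (Real.cos θ • p.1 + Real.sin θ • p.2)))) := by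
    intro p
    rw [Finset.mul_sum]
    exact Finset.sum_congr rfl fun i _ => by ring
  have i1 := fun i => ((IsTest.mul (contDiff_coord i) hu).integrable_mul_comp_rotation
    (hu.pderiv i) (Real.cos θ) (Real.sin θ)).const_mul (-Real.sin θ)
  have i2 := fun i => (hu.integrable_snd_mul_comp_rotation
    (hu.pderiv i) (Real.cos θ) (Real.sin θ) i).const_mul (Real.cos θ)
  have i3 : ∀ i, Integrable (fun p : E n × E n =>
      -Real.sin θ * ((p.1 i * u p.1) * pderiv i u (Real.cos θ • p.1 + Real.sin θ • p.2)) +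
        Real.cos θ * (p.2 i * (u p.1 * pderiv i u (Real.cos θ • p.1 + Real.sin θ • p.2))))
      ((stdGaussian (E n)).prod (stdGaussian (E n))) := fun i => (i1 i).add (i2 i)
  simp_rw [h1]
  rw [integral_finsetSum _ fun i _ => i3 i, Finset.mul_sum]
  refine Finset.sum_congr rfl fun i _ => ?_
  rw [integral_add (i1 i) (i2 i), integral_const_mul, integral_const_mul,
    integral_fst_mul_comp_rotation hu (hu.pderiv i),
    integral_snd_mul_comp_rotation hu (hu.pderiv i) hs]
  ring

lemma integral_comp_fst_stdGaussian_prod (v : E n → ℝ) :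
    ∫ p, v p.1 ∂((stdGaussian (E n)).prod (stdGaussian (E n))) =
      ∫ x, v x ∂(stdGaussian (E n)) := by
  have := integral_prod_mul (μ := stdGaussian (E n)) (ν := stdGaussian (E n)) v (fun _ => (1 : ℝ))
  simpa using this

lemma IsTest.integral_comp_rotation {v : E n → ℝ} (hv : IsTest v) (θ : ℝ) :
    ∫ p, v (Real.cos θ • p.1 + Real.sin θ • p.2)
      ∂((stdGaussian (E n)).prod (stdGaussian (E n))) = ∫ x, v x ∂(stdGaussian (E n)) := by
  conv_rhs => rw [← map_stdGaussian_prod (n := n) (Real.cos_sq_add_sin_sq θ), integral_map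
    (by fun_prop) hv.1.continuous.aestronglyMeasurable]

/-- By `ab ≤ (a² + b²)/2`, since the rotated vector has the same law as the first one. -/
lemma integral_mul_comp_rotation_le {v : E n → ℝ} (hv : IsTest v) (θ : ℝ) :
    ∫ p, v p.1 * v (Real.cos θ • p.1 + Real.sin θ • p.2)
      ∂((stdGaussian (E n)).prod (stdGaussian (E n))) ≤ ∫ x, v x ^ 2 ∂(stdGaussian (E n)) := by
  have ht : IsTest fun x => v x ^ 2 := by
    simp_rw [sq]
    exact IsTest.mul hv.1 hv
  have hc := ht.1.continuous
  obtain ⟨B, hB⟩ := ht.exists_bound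
  have i1 : Integrable (fun p : E n × E n => v p.1 ^ 2)
      ((stdGaussian (E n)).prod (stdGaussian (E n))) := (ht.integrable _).comp_fst _
  have i2 : Integrable (fun p : E n × E n => v (Real.cos θ • p.1 + Real.sin θ • p.2) ^ 2)
      ((stdGaussian (E n)).prod (stdGaussian (E n))) :=
    Integrable.of_bound (C := B) (Continuous.aestronglyMeasurable
      (hc.comp (by fun_prop : Continuous fun p : E n × E n =>
        Real.cos θ • p.1 + Real.sin θ • p.2))) (ae_of_all _ fun p => hB _)
  have h := integral_mono (hv.integrable_mul_comp_rotation hv (Real.cos θ) (Real.sin θ))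
    ((i1.add i2).const_mul (1 / 2)) fun p => by
      simp only [Pi.add_apply]
      nlinarith [sq_nonneg (v p.1 - v (Real.cos θ • p.1 + Real.sin θ • p.2))]
  refine h.trans (le_of_eq ?_)
  rw [integral_const_mul, integral_add' i1 i2, integral_comp_fst_stdGaussian_prod fun x => v x ^ 2, ht.integral_comp_rotation]
  ring

/-- With `X`, `Y` independent, `φ θ = E[u(X) u(X cos θ + Y sin θ)]` interpolates between `E[u²]` at
`0` and `(E u)²` at `π/2`. Its derivative is at least `-K sin θ`, so `φ - K cos` is monotone;
comparing the endpoints gives the claim. -/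
lemma poincare_test {u : E n → ℝ} (hu : IsTest u) :
    ∫ x, u x ^ 2 ∂(stdGaussian (E n)) - (∫ x, u x ∂(stdGaussian (E n))) ^ 2 ≤
      ∑ i, ∫ x, pderiv i u x ^ 2 ∂(stdGaussian (E n)) := by
  set K := ∑ i, ∫ x, pderiv i u x ^ 2 ∂(stdGaussian (E n)) with hK
  set φ : ℝ → ℝ := fun θ => ∫ p, u p.1 * u (Real.cos θ • p.1 + Real.sin θ • p.2)
        ∂((stdGaussian (E n)).prod (stdGaussian (E n))) with hφ
  have hd : ∀ θ, HasDerivAt φ _ θ := fun θ => hasDerivAt_integral_rotation hu θ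
  have hdψ := fun θ => (hd θ).sub ((Real.hasDerivAt_cos θ).const_mul K)
  have hmono : MonotoneOn (φ - fun θ => K * Real.cos θ) (Set.Icc 0 (Real.pi / 2)) := by
    refine monotoneOn_of_deriv_nonneg (convex_Icc _ _)
      (fun θ _ => (hdψ θ).continuousAt.continuousWithinAt)
      (fun θ _ => (hdψ θ).differentiableAt.differentiableWithinAt) fun θ hθ => ?_
    rw [interior_Icc] at hθ
    have hs : 0 < Real.sin θ :=
      Real.sin_pos_of_pos_of_lt_pi hθ.1 (hθ.2.trans (by linarith [Real.pi_pos]))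
    rw [(hdψ θ).deriv, integral_deriv_rotation hu hs.ne']
    have : ∑ i, ∫ p, pderiv i u p.1 * pderiv i u (Real.cos θ • p.1 + Real.sin θ • p.2)
        ∂((stdGaussian (E n)).prod (stdGaussian (E n))) ≤ K :=
      Finset.sum_le_sum fun i _ => integral_mul_comp_rotation_le (hu.pderiv i) θ
    nlinarith
  have h := hmono (Set.left_mem_Icc.2 (by positivity)) (Set.right_mem_Icc.2 (by positivity))
    (by positivity)
  have h0 : φ 0 = ∫ x, u x ^ 2 ∂(stdGaussian (E n)) := by
    have := integral_comp_fst_stdGaussian_prod fun x => u x * u x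
    simp only [← sq] at this
    simpa [hφ, ← sq] using this
  have h1 : φ (Real.pi / 2) = (∫ x, u x ∂(stdGaussian (E n))) ^ 2 := by
    have := integral_prod_mul (μ := stdGaussian (E n)) (ν := stdGaussian (E n)) u u
    simpa [hφ, sq] using this
  simp only [Pi.sub_apply, h0, h1, Real.cos_zero, Real.cos_pi_div_two] at h
  linarith

/-- The **Gaussian Poincaré inequality**. -/
lemma IsSobolev.poincare {u : E n → ℝ} {g : Fin n → E n → ℝ} (h : IsSobolev u g) :
    ∫ x, u x ^ 2 ∂(stdGaussian (E n)) - (∫ x, u x ∂(stdGaussian (E n))) ^ 2 ≤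
      ∑ i, ∫ x, g i x ^ 2 ∂(stdGaussian (E n)) := by
  obtain ⟨v, hv, hvu, hvg⟩ := h.exists_test_seq
  have t1 := tendsto_integral_mul (fun m => (hv m).memLp 2 _) h.memLp
    (fun m => (hv m).memLp 2 _) h.memLp hvu hvu
  have t2 := tendsto_integral_of_eLpNorm (fun m => (hv m).memLp 2 _) h.memLp hvu
  have t3 := tendsto_finsetSum Finset.univ fun i _ =>
    tendsto_integral_mul (fun m => ((hv m).pderiv i).memLp 2 _) (h.memLp_partial i)
      (fun m => ((hv m).pderiv i).memLp 2 _) (h.memLp_partial i) (hvg i) (hvg i)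
  simp only [← sq] at t1 t3
  exact le_of_tendsto_of_tendsto' (t1.sub (t2.pow 2)) t3 fun m => poincare_test (hv m)

end QuadApprox

namespace QuadApprox

/-! ### Moments of `zᵀ f(z) - div f(z)` -/

variable {n : ℕ} {f g : E n → E n} {F G : E n → Mat n}

lemma IsGaussianSobolev.isSobolev (hf : IsGaussianSobolev f F) (j : Fin n) :
    IsSobolev (fun x => f x j) (fun i x => F x i j) :=
  ⟨fun i => hf.isWeakGradient i j, hf.memLp j, fun i => hf.memLp_gradient i j⟩

lemma steinFun_eq_sum (f : E n → E n) (F : E n → Mat n) (x : E n) :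
    steinFun f F x = ∑ j, (x j * f x j - F x j j) := by
  rw [steinFun, Finset.sum_sub_distrib, PiLp.inner_apply, Matrix.trace]
  simp [mul_comm]

lemma IsGaussianSobolev.memLp_steinFun (hf : IsGaussianSobolev f F) :
    MemLp (steinFun f F) 2 (stdGaussian (E n)) := by
  have : steinFun f F = fun x => ∑ j, (x j * f x j - F x j j) := funext (steinFun_eq_sum f F)
  rw [this]
  exact memLp_finsetSum _ fun j _ => (hf.isSobolev j).memLp_creation j

lemma IsGaussianSobolev.integral_steinFun (hf : IsGaussianSobolev f F) :
    ∫ x, steinFun f F x ∂(stdGaussian (E n)) = 0 := by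
  simp_rw [steinFun_eq_sum]
  rw [integral_finsetSum _ fun j _ =>
    ((hf.isSobolev j).memLp_creation j).integrable (by norm_num)]
  exact Finset.sum_eq_zero fun j _ => (hf.isSobolev j).integral_creation j

/-- The polarized isometry for `f ↦ zᵀ f(z) - div f(z)`. -/
lemma IsGaussianSobolev.integral_steinFun_mul (hf : IsGaussianSobolev f F)
    (hg : IsGaussianSobolev g G) :
    ∫ x, steinFun f F x * steinFun g G x ∂(stdGaussian (E n)) =
      ∑ i, ∫ x, f x i * g x i ∂(stdGaussian (E n)) +
        ∑ i, ∑ j, ∫ x, F x j i * G x i j ∂(stdGaussian (E n)) := by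
  have hint : ∀ i j, Integrable (fun x => (x i * f x i - F x i i) * (x j * g x j - G x j j))
      (stdGaussian (E n)) := fun i j =>
    ((hf.isSobolev i).memLp_creation i).integrable_mul ((hg.isSobolev j).memLp_creation j)
  simp_rw [steinFun_eq_sum, Finset.sum_mul_sum]
  rw [integral_finsetSum _ fun i _ => integrable_finsetSum _ fun j _ => hint i j]
  simp_rw [integral_finsetSum _ fun j _ => hint _ j,
    (hf.isSobolev _).integral_creation_mul_creation (hg.isSobolev _), Finset.sum_add_distrib]
  simp

/-- Stein's identity `E[zᵢ u(z)] = E[∂ᵢ u(z)]`. -/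
lemma IsSobolev.integral_coord_mul {u : E n → ℝ} {h : Fin n → E n → ℝ} (hu : IsSobolev u h)
    (i : Fin n) :
    ∫ x, x i * u x ∂(stdGaussian (E n)) = ∫ x, h i x ∂(stdGaussian (E n)) := by
  have h0 := hu.integral_creation i
  rwa [integral_sub ((memLp_one_coord_mul hu.memLp i).integrable le_rfl)
    ((hu.memLp_partial i).integrable (by norm_num)), sub_eq_zero] at h0

lemma toEuclideanCLM_apply_coord (B : Mat n) (x : E n) (j : Fin n) :
    Matrix.toEuclideanCLM (n := Fin n) (𝕜 := ℝ) B x j = ∑ k, B j k * x k := by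
  simp [Matrix.ofLp_toEuclideanCLM, Matrix.mulVec, dotProduct]

/-- The transpose reflects the convention that the gradient of the `j`-th coordinate is the `j`-th
column. -/
lemma isGaussianSobolev_affine (ν : E n) (B : Mat n) :
    IsGaussianSobolev (fun x => ν + Matrix.toEuclideanCLM (n := Fin n) (𝕜 := ℝ) B x)
      (fun _ => B.transpose) := by
  have hsm : ∀ j, ContDiff ℝ (⊤ : ℕ∞) fun x : E n =>
      (ν + Matrix.toEuclideanCLM (n := Fin n) (𝕜 := ℝ) B x) j := fun j =>
    (contDiff_coord j).comp (contDiff_const.add (ContinuousLinearMap.contDiff _))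
  refine ⟨fun i j => ?_, fun j => ?_, fun i j => memLp_const _⟩
  · convert isWeakPartial_of_contDiff (hsm j) i using 1
    funext x
    have h1 : HasFDerivAt (fun x : E n => (ν + Matrix.toEuclideanCLM (n := Fin n) (𝕜 := ℝ) B x) j)
        ((EuclideanSpace.proj (𝕜 := ℝ) j).comp
          (Matrix.toEuclideanCLM (n := Fin n) (𝕜 := ℝ) B)) x :=
      (EuclideanSpace.proj (𝕜 := ℝ) j).hasFDerivAt.comp x
        ((ContinuousLinearMap.hasFDerivAt _).const_add ν)
    rw [pderiv, h1.fderiv]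
    change B j i = Matrix.toEuclideanCLM (n := Fin n) (𝕜 := ℝ) B (EuclideanSpace.single i 1) j
    rw [toEuclideanCLM_apply_coord]
    simp
  · have h1 : MemLp (fun _ : E n => ν j) 2 (stdGaussian (E n)) := memLp_const _
    have h2 : MemLp (fun x : E n => ∑ k, B j k * x k) 2 (stdGaussian (E n)) :=
      memLp_finsetSum _ fun k _ => (memLp_coord k 2 (by simp)).const_mul _
    simp only [PiLp.add_apply, toEuclideanCLM_apply_coord]
    exact h1.add h2

/-- The approximants lie in the range of the same divergence operator, so the isometry applies to
them. -/
lemma quadFun_eq_steinFun (ν : E n) (B : Mat n) :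
    quadFun ν B = steinFun (fun x => ν + Matrix.toEuclideanCLM (n := Fin n) (𝕜 := ℝ) B x)
      (fun _ => B.transpose) := by
  funext x
  simp [quadFun, steinFun]

lemma integral_coord (i : Fin n) : ∫ x : E n, x i ∂(stdGaussian (E n)) = 0 := by
  have := integral_strongDual_stdGaussian (E := E n) (EuclideanSpace.proj (𝕜 := ℝ) i)
  simpa using this

/-- The covariance of `ξ` with `ξ_{ν,B}` depends only on `E[f(z)]` and `E[∇f(z)]`. -/
lemma IsGaussianSobolev.integral_steinFun_mul_quadFun (hf : IsGaussianSobolev f F) {μ : E n}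
    {A : Mat n} (hμ : ∀ i, ∫ x, f x i ∂(stdGaussian (E n)) = μ i)
    (hA : ∀ i j, ∫ x, F x i j ∂(stdGaussian (E n)) = A i j) (ν : E n) (B : Mat n) :
    ∫ x, steinFun f F x * quadFun ν B x ∂(stdGaussian (E n)) =
      ∑ i, μ i * ν i + ∑ i, ∑ j, A i j * (B i j + B j i) := by
  -- Stein's identity: the first moments of `f` against `z` are mean derivatives, so no further
  -- information on `f` enters.
  have hxf : ∀ i k, ∫ x : E n, f x i * x k ∂(stdGaussian (E n)) = A k i := by
    intro i k
    simp_rw [mul_comm (f _ i)]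
    rw [(hf.isSobolev i).integral_coord_mul k, hA]
  have i1 : ∀ i, Integrable (fun x => f x i) (stdGaussian (E n)) := fun i =>
    (hf.memLp i).integrable (by norm_num)
  have i2 : ∀ i k, Integrable (fun x : E n => f x i * x k) (stdGaussian (E n)) := fun i k =>
    (hf.memLp i).integrable_mul (memLp_coord k 2 (by simp))
  rw [quadFun_eq_steinFun, hf.integral_steinFun_mul (isGaussianSobolev_affine ν B)]
  have h1 : ∀ i, ∫ x, f x i * (ν + Matrix.toEuclideanCLM (n := Fin n) (𝕜 := ℝ) B x) i
      ∂(stdGaussian (E n)) = μ i * ν i + ∑ k, A k i * B i k := by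
    intro i
    have h2 : ∀ x : E n, f x i * (ν + Matrix.toEuclideanCLM (n := Fin n) (𝕜 := ℝ) B x) i =
        f x i * ν i + ∑ k, f x i * x k * B i k := by
      intro x
      rw [PiLp.add_apply, toEuclideanCLM_apply_coord, mul_add, Finset.mul_sum]
      congr 1
      exact Finset.sum_congr rfl fun k _ => by ring
    simp_rw [h2]
    rw [integral_add ((i1 i).mul_const _) (integrable_finsetSum _ fun k _ => (i2 i k).mul_const _),
      integral_mul_const, integral_finsetSum _ fun k _ => (i2 i k).mul_const _, hμ]
    simp_rw [integral_mul_const, hxf]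
  simp_rw [h1, integral_mul_const, hA, Matrix.transpose_apply, Finset.sum_add_distrib]
  rw [add_assoc]
  congr 1
  rw [Finset.sum_comm]
  simp_rw [mul_add, Finset.sum_add_distrib]
  rw [add_comm]
  congr 1
  exact Finset.sum_comm

lemma integral_quadFun_mul_quadFun (μ ν : E n) (A B : Mat n) :
    ∫ x, quadFun μ A x * quadFun ν B x ∂(stdGaussian (E n)) =
      ∑ i, μ i * ν i + ∑ i, ∑ j, A i j * (B i j + B j i) := by
  have hi : ∀ k, Integrable (fun x : E n => x k) (stdGaussian (E n)) := fun k =>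
    (memLp_coord k 1 (by simp)).integrable le_rfl
  have h := (isGaussianSobolev_affine μ A).integral_steinFun_mul_quadFun (μ := μ)
    (A := A.transpose) (fun i => ?_) (fun i j => by simp) ν B
  · rw [quadFun_eq_steinFun μ A, h, Finset.sum_comm (f := fun i j => A.transpose i j * _)]
    simp only [Matrix.transpose_apply]
    congr 1
    exact Finset.sum_congr rfl fun i _ => Finset.sum_congr rfl fun j _ => by ring
  · simp_rw [PiLp.add_apply, toEuclideanCLM_apply_coord]
    rw [integral_add (integrable_const _) (integrable_finsetSum _ fun k _ => (hi k).const_mul _),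
      integral_finsetSum _ fun k _ => (hi k).const_mul _]
    simp [integral_const_mul, integral_coord]

/-- The right side, `‖M‖_F² + tr(M²)`, is the combination produced by the isometry. -/
lemma two_mul_frobSq_symPart (M : Mat n) :
    2 * frobSq (symPart M) = ∑ i, ∑ j, M i j ^ 2 + ∑ i, ∑ j, M i j * M j i := by
  have h1 : ∀ i j, symPart M i j ^ 2 = (1 / 4) * M i j ^ 2 + (1 / 4) * M j i ^ 2 +
      (1 / 2) * (M i j * M j i) := by
    intro i j
    simp only [symPart, Matrix.smul_apply, Matrix.add_apply, Matrix.transpose_apply, smul_eq_mul]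
    ring
  simp_rw [frobSq, h1, Finset.sum_add_distrib, ← Finset.mul_sum]
  rw [Finset.sum_comm (f := fun i j => M j i ^ 2)]
  ring

lemma frobSq_nonneg (M : Mat n) : 0 ≤ frobSq M :=
  Finset.sum_nonneg fun _ _ => Finset.sum_nonneg fun _ _ => sq_nonneg _

lemma integral_quadFun_sq (ν : E n) (B : Mat n) :
    ∫ x, quadFun ν B x ^ 2 ∂(stdGaussian (E n)) = ‖ν‖ ^ 2 + 2 * frobSq (symPart B) := by
  simp_rw [sq (quadFun ν B _)]
  rw [integral_quadFun_mul_quadFun, two_mul_frobSq_symPart, EuclideanSpace.real_norm_sq_eq]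
  simp_rw [mul_add, Finset.sum_add_distrib, ← sq]

lemma IsGaussianSobolev.integral_steinFun_sq (hf : IsGaussianSobolev f F) :
    ∫ x, steinFun f F x ^ 2 ∂(stdGaussian (E n)) =
      ∑ i, ∫ x, f x i ^ 2 ∂(stdGaussian (E n)) +
        ∑ i, ∑ j, ∫ x, F x i j * F x j i ∂(stdGaussian (E n)) := by
  simp_rw [sq]
  rw [hf.integral_steinFun_mul hf]
  congr 1
  refine Finset.sum_congr rfl fun i _ => Finset.sum_congr rfl fun j _ => ?_
  exact integral_congr_ae (ae_of_all _ fun x => mul_comm _ _)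

lemma integral_sub_mul_sub {u v : E n → ℝ} (hu : MemLp u 2 (stdGaussian (E n)))
    (hv : MemLp v 2 (stdGaussian (E n))) {c d : ℝ} (hc : ∫ x, u x ∂(stdGaussian (E n)) = c)
    (hd : ∫ x, v x ∂(stdGaussian (E n)) = d) :
    ∫ x, (u x - c) * (v x - d) ∂(stdGaussian (E n)) =
      ∫ x, u x * v x ∂(stdGaussian (E n)) - c * d := by
  have h : ∀ x, (u x - c) * (v x - d) = u x * v x - (d * u x + c * (v x - d)) :=
    fun x => by ring
  have hi : Integrable (fun x => d * u x) (stdGaussian (E n)) :=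
    (hu.integrable one_le_two).const_mul d
  have hj : Integrable (fun x => c * (v x - d)) (stdGaussian (E n)) :=
    ((hv.integrable one_le_two).sub (integrable_const d)).const_mul c
  have hk : Integrable (fun x => d * u x + c * (v x - d)) (stdGaussian (E n)) := hi.add hj
  have hl : Integrable (fun x => u x * v x) (stdGaussian (E n)) := hu.integrable_mul hv
  simp_rw [h]
  rw [integral_sub hl hk, integral_add hi hj, integral_const_mul, integral_const_mul,
    integral_sub (hv.integrable one_le_two) (integrable_const d), hc, hd]
  simp
  ring

lemma integral_sub_sq {u : E n → ℝ} (hu : MemLp u 2 (stdGaussian (E n))) {c : ℝ}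
    (hc : ∫ x, u x ∂(stdGaussian (E n)) = c) :
    ∫ x, (u x - c) ^ 2 ∂(stdGaussian (E n)) = ∫ x, u x ^ 2 ∂(stdGaussian (E n)) - c ^ 2 := by
  simp_rw [sq]
  exact integral_sub_mul_sub hu hu hc hc

lemma integrable_two_mul_frobSq_symPart {H : E n → Mat n}
    (hH : ∀ i j, MemLp (fun x => H x i j) 2 (stdGaussian (E n))) :
    Integrable (fun x => frobSq (symPart (H x))) (stdGaussian (E n)) ∧
      2 * ∫ x, frobSq (symPart (H x)) ∂(stdGaussian (E n)) =
        ∑ i, ∑ j, ∫ x, H x i j ^ 2 ∂(stdGaussian (E n)) +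
          ∑ i, ∑ j, ∫ x, H x i j * H x j i ∂(stdGaussian (E n)) := by
  have e : ∀ x, frobSq (symPart (H x)) =
      (1 / 2) * (∑ i, ∑ j, H x i j ^ 2 + ∑ i, ∑ j, H x i j * H x j i) := fun x => by
    rw [← two_mul_frobSq_symPart]
    ring
  have i1 : ∀ i j, Integrable (fun x => H x i j ^ 2) (stdGaussian (E n)) := fun i j =>
    (hH i j).integrable_sq
  have i2 : ∀ i j, Integrable (fun x => H x i j * H x j i) (stdGaussian (E n)) := fun i j =>
    (hH i j).integrable_mul (hH j i)
  have s1 : Integrable (fun x => ∑ i, ∑ j, H x i j ^ 2) (stdGaussian (E n)) :=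
    integrable_finsetSum _ fun i _ => integrable_finsetSum _ fun j _ => i1 i j
  have s2 : Integrable (fun x => ∑ i, ∑ j, H x i j * H x j i) (stdGaussian (E n)) :=
    integrable_finsetSum _ fun i _ => integrable_finsetSum _ fun j _ => i2 i j
  simp_rw [e]
  refine ⟨(s1.add s2).const_mul _, ?_⟩
  rw [integral_const_mul, integral_add s1 s2,
    integral_finsetSum _ fun i _ => integrable_finsetSum _ fun j _ => i1 i j,
    integral_finsetSum _ fun i _ => integrable_finsetSum _ fun j _ => i2 i j]
  simp_rw [integral_finsetSum _ fun j _ => i1 _ j, integral_finsetSum _ fun j _ => i2 _ j]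
  ring

/-! ### Centring at the mean vector and the mean gradient. -/

section Means

variable {μ : E n} {A : Mat n}

lemma IsGaussianSobolev.memLp_sub_mean (hf : IsGaussianSobolev f F) (A : Mat n) (i j : Fin n) :
    MemLp (fun x => (F x - A) i j) 2 (stdGaussian (E n)) :=
  (hf.memLp_gradient i j).sub (memLp_const (A i j))

/-- A bias-variance identity: `M ↦ ‖Mˢ‖_F²` is a quadratic form, so centring subtracts exactly its
value at the mean. -/
lemma IsGaussianSobolev.two_mul_integral_frobSq_symPart_sub (hf : IsGaussianSobolev f F)
    (hA : ∀ i j, ∫ x, F x i j ∂(stdGaussian (E n)) = A i j) :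
    2 * ∫ x, frobSq (symPart (F x - A)) ∂(stdGaussian (E n)) =
      2 * ∫ x, frobSq (symPart (F x)) ∂(stdGaussian (E n)) - 2 * frobSq (symPart A) := by
  rw [(integrable_two_mul_frobSq_symPart (hf.memLp_sub_mean A)).2,
    (integrable_two_mul_frobSq_symPart hf.memLp_gradient).2, two_mul_frobSq_symPart]
  simp_rw [Matrix.sub_apply, integral_sub_sq (hf.memLp_gradient _ _) (hA _ _),
    integral_sub_mul_sub (hf.memLp_gradient _ _) (hf.memLp_gradient _ _) (hA _ _) (hA _ _),
    Finset.sum_sub_distrib]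
  ring

lemma IsGaussianSobolev.integral_trace_sub_sq (hf : IsGaussianSobolev f F)
    (hA : ∀ i j, ∫ x, F x i j ∂(stdGaussian (E n)) = A i j) :
    AEStronglyMeasurable (fun x => ((F x - A) ^ 2).trace) (stdGaussian (E n)) ∧
    ∫ x, ((F x - A) ^ 2).trace ∂(stdGaussian (E n)) =
      ∑ i, ∑ j, ∫ x, F x i j * F x j i ∂(stdGaussian (E n)) - ∑ i, ∑ j, A i j * A j i := by
  have e : ∀ x, ((F x - A) ^ 2).trace = ∑ i, ∑ j, (F x - A) i j * (F x - A) j i := fun x => by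
    simp [sq, Matrix.trace, Matrix.mul_apply]
  have i1 : ∀ i j, Integrable (fun x => (F x - A) i j * (F x - A) j i) (stdGaussian (E n)) :=
    fun i j => (hf.memLp_sub_mean A i j).integrable_mul (hf.memLp_sub_mean A j i)
  simp_rw [e]
  refine ⟨(integrable_finsetSum _ fun i _ => integrable_finsetSum _ fun j _ => i1 i j).1, ?_⟩
  rw [integral_finsetSum _ fun i _ => integrable_finsetSum _ fun j _ => i1 i j]
  simp_rw [integral_finsetSum _ fun j _ => i1 _ j, Matrix.sub_apply,
    integral_sub_mul_sub (hf.memLp_gradient _ _) (hf.memLp_gradient _ _) (hA _ _) (hA _ _),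
    Finset.sum_sub_distrib]

lemma IsGaussianSobolev.integral_norm_sub_sq (hf : IsGaussianSobolev f F)
    (hμ : ∀ i, ∫ x, f x i ∂(stdGaussian (E n)) = μ i) (c : ℝ) :
    AEStronglyMeasurable (fun x => ‖f x - μ‖ ^ 2 - c) (stdGaussian (E n)) ∧
    ∫ x, (‖f x - μ‖ ^ 2 - c) ∂(stdGaussian (E n)) =
      ∑ i, ∫ x, f x i ^ 2 ∂(stdGaussian (E n)) - ‖μ‖ ^ 2 - c := by
  have i1 : ∀ i, Integrable (fun x => (f x i - μ i) ^ 2) (stdGaussian (E n)) :=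
    fun i => ((hf.memLp i).sub (memLp_const (μ i))).integrable_sq
  have i2 := integrable_finsetSum Finset.univ fun i _ => i1 i
  simp_rw [EuclideanSpace.real_norm_sq_eq, PiLp.sub_apply]
  refine ⟨(i2.sub (integrable_const c)).1, ?_⟩
  rw [integral_sub i2 (integrable_const c), integral_finsetSum _ fun i _ => i1 i]
  simp_rw [integral_sub_sq (hf.memLp _) (hμ _), Finset.sum_sub_distrib]
  simp

/-- The squared error when `h(z)` and `ξ_{ν,B}` have the covariance `E[ξ_{ν,B}²]`. -/
lemma integral_sub_quadFun_sq {h : E n → ℝ} (hh : MemLp h 2 (stdGaussian (E n))) {ν : E n}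
    {B : Mat n} (hcov : ∫ x, h x * quadFun ν B x ∂(stdGaussian (E n)) =
      ‖ν‖ ^ 2 + 2 * frobSq (symPart B)) :
    ∫ x, (h x - quadFun ν B x) ^ 2 ∂(stdGaussian (E n)) =
      ∫ x, h x ^ 2 ∂(stdGaussian (E n)) - (‖ν‖ ^ 2 + 2 * frobSq (symPart B)) := by
  have he : ∀ x, (h x - quadFun ν B x) ^ 2 =
      h x ^ 2 - (2 * (h x * quadFun ν B x) - quadFun ν B x ^ 2) := fun x => by ring
  have i2 : Integrable (fun x => 2 * (h x * quadFun ν B x)) (stdGaussian (E n)) :=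
    (hh.integrable_mul (memLp_quadFun ν B)).const_mul 2
  have i3 := (memLp_quadFun ν B).integrable_sq
  have i4 : Integrable (fun x => 2 * (h x * quadFun ν B x) - quadFun ν B x ^ 2)
      (stdGaussian (E n)) := i2.sub i3
  simp_rw [he]
  rw [integral_sub hh.integrable_sq i4, integral_sub i2 i3, integral_const_mul, hcov,
    integral_quadFun_sq]
  ring

lemma IsGaussianSobolev.integral_steinFun_mul_quadFun_mean (hf : IsGaussianSobolev f F)
    (hμ : ∀ i, ∫ x, f x i ∂(stdGaussian (E n)) = μ i)
    (hA : ∀ i j, ∫ x, F x i j ∂(stdGaussian (E n)) = A i j) :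
    ∫ x, steinFun f F x * quadFun μ A x ∂(stdGaussian (E n)) =
      ‖μ‖ ^ 2 + 2 * frobSq (symPart A) := by
  rw [hf.integral_steinFun_mul_quadFun hμ hA, ← integral_quadFun_mul_quadFun]
  simp_rw [← sq]
  rw [integral_quadFun_sq]

lemma IsGaussianSobolev.error_eq (hf : IsGaussianSobolev f F)
    (hμ : ∀ i, ∫ x, f x i ∂(stdGaussian (E n)) = μ i)
    (hA : ∀ i j, ∫ x, F x i j ∂(stdGaussian (E n)) = A i j) :
    ∫ x, (steinFun f F x - quadFun μ A x) ^ 2 ∂(stdGaussian (E n)) =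
      ∫ x, (‖f x - μ‖ ^ 2 - frobSq A) ∂(stdGaussian (E n)) +
        ∫ x, ((F x - A) ^ 2).trace ∂(stdGaussian (E n)) := by
  rw [integral_sub_quadFun_sq hf.memLp_steinFun (hf.integral_steinFun_mul_quadFun_mean hμ hA),
    hf.integral_steinFun_sq,
    (hf.integral_norm_sub_sq hμ _).2, (hf.integral_trace_sub_sq hA).2, two_mul_frobSq_symPart,
    frobSq]
  ring

/-- Poincaré, summed over the coordinates, bounds `E‖f - μ‖²` by `E‖∇f‖_F²`. Subtracting `‖A‖_F²`
centres the gradient, and the trace term completes the symmetrized norm. -/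
lemma IsGaussianSobolev.error_le (hf : IsGaussianSobolev f F)
    (hμ : ∀ i, ∫ x, f x i ∂(stdGaussian (E n)) = μ i)
    (hA : ∀ i j, ∫ x, F x i j ∂(stdGaussian (E n)) = A i j) :
    ∫ x, (‖f x - μ‖ ^ 2 - frobSq A) ∂(stdGaussian (E n)) +
        ∫ x, ((F x - A) ^ 2).trace ∂(stdGaussian (E n)) ≤
      2 * ∫ x, frobSq (symPart (F x - A)) ∂(stdGaussian (E n)) := by
  have hp : ∑ i, ∫ x, f x i ^ 2 ∂(stdGaussian (E n)) - ‖μ‖ ^ 2 ≤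
      ∑ i, ∑ j, ∫ x, F x i j ^ 2 ∂(stdGaussian (E n)) := by
    rw [EuclideanSpace.real_norm_sq_eq, ← Finset.sum_sub_distrib, Finset.sum_comm]
    refine Finset.sum_le_sum fun j _ => ?_
    rw [← hμ]
    exact (hf.isSobolev j).poincare
  rw [(hf.integral_norm_sub_sq hμ _).2, (hf.integral_trace_sub_sq hA).2,
    hf.two_mul_integral_frobSq_symPart_sub hA, two_mul_frobSq_symPart,
    (integrable_two_mul_frobSq_symPart hf.memLp_gradient).2, frobSq]
  linarith

end Means

end QuadApprox

namespace QuadApprox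

/-! ### Projections and error bounds on a probability space -/

section Projection

variable {Ω : Type*} [MeasurableSpace Ω] {P : Measure Ω} {n : ℕ} {z : Ω → E n}

lemma integral_comp_of_hasLaw (hz : HasLaw z (stdGaussian (E n)) P) {h : E n → ℝ}
    (hh : AEStronglyMeasurable h (stdGaussian (E n))) :
    ∫ ω, h (z ω) ∂P = ∫ x, h x ∂(stdGaussian (E n)) :=
  hz.integral_comp hh

lemma meanVec_apply [IsProbabilityMeasure P] (hz : HasLaw z (stdGaussian (E n)) P)
    {f : E n → E n} {F : E n → Mat n} (hf : IsGaussianSobolev f F) (i : Fin n) :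
    ∫ x, f x i ∂(stdGaussian (E n)) = meanVec P z f i := by
  have h1 : ∀ i, Integrable (fun ω => f (z ω) i) P := by
    intro i
    have h := (hf.memLp i).integrable one_le_two
    rw [← hz.map_eq] at h
    exact h.comp_aemeasurable hz.aemeasurable
  rw [meanVec, eval_integral_piLp h1, integral_comp_of_hasLaw hz (hf.memLp i).1]

lemma meanMat_apply (hz : HasLaw z (stdGaussian (E n)) P)
    {f : E n → E n} {F : E n → Mat n} (hf : IsGaussianSobolev f F) (i j : Fin n) :
    ∫ x, F x i j ∂(stdGaussian (E n)) = meanMat P z F i j := by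
  rw [meanMat, Matrix.of_apply, integral_comp_of_hasLaw hz (hf.memLp_gradient i j).1]

lemma memLp_comp_of_hasLaw (hz : HasLaw z (stdGaussian (E n)) P) {h : E n → ℝ}
    (hh : MemLp h 2 (stdGaussian (E n))) : MemLp (fun ω => h (z ω)) 2 P := by
  rw [← hz.map_eq] at hh
  exact hh.comp_of_map hz.aemeasurable

lemma inner_toLp_quadLp (hz : HasLaw z (stdGaussian (E n)) P) {h : E n → ℝ}
    (hh : MemLp h 2 (stdGaussian (E n))) (ν : E n) (B : Mat n) :
    inner ℝ ((memLp_comp_of_hasLaw hz hh).toLp _) (quadLp hz (ν, B)) =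
      ∫ x, h x * quadFun ν B x ∂(stdGaussian (E n)) := by
  refine (inner_toLp (memLp_comp_of_hasLaw hz hh) (memLp_quadFun_comp hz ν B)).trans ?_
  exact integral_comp_of_hasLaw hz (hh.1.mul (memLp_quadFun ν B).1)

/-- A criterion for `ξ_{μ,A}` to be the projection of `h(z)`. -/
lemma starProjection_eq_quadLp (hz : HasLaw z (stdGaussian (E n)) P)
    (K : Submodule ℝ (Lp ℝ 2 P)) [K.HasOrthogonalProjection]
    {h : E n → ℝ} (hh : MemLp h 2 (stdGaussian (E n))) (μ : E n) (A : Mat n)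
    (hmem : quadLp hz (μ, A) ∈ K)
    (horth : ∀ w ∈ K, ∃ ν B, w = quadLp hz (ν, B) ∧
      ∫ x, h x * quadFun ν B x ∂(stdGaussian (E n)) =
        ∫ x, quadFun μ A x * quadFun ν B x ∂(stdGaussian (E n))) :
    K.starProjection ((memLp_comp_of_hasLaw hz hh).toLp _) = quadLp hz (μ, A) := by
  refine (Submodule.eq_starProjection_of_mem_of_inner_eq_zero hmem fun w hw => ?_)
  obtain ⟨ν, B, rfl, he⟩ := horth w hw
  rw [inner_sub_left, inner_toLp_quadLp hz hh, he, sub_eq_zero]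
  exact (inner_toLp_quadLp hz (memLp_quadFun μ A) ν B).symm

/-- Only covariances with quadratic polynomials matter for the projections. Stating this for a
general `h` covers both `ξ` and `ξ_{μ,A}`; linear and quadratic parts are orthogonal, so restricting
to `H₁` or `H₂` drops one of them. -/
lemma starProjection_chaos (hz : HasLaw z (stdGaussian (E n)) P) {h : E n → ℝ}
    (hh : MemLp h 2 (stdGaussian (E n))) (μ : E n) (A : Mat n)
    (hcov : ∀ ν B, ∫ x, h x * quadFun ν B x ∂(stdGaussian (E n)) =
      ∑ i, μ i * ν i + ∑ i, ∑ j, A i j * (B i j + B j i)) :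
    (chaos12 hz).starProjection ((memLp_comp_of_hasLaw hz hh).toLp _) = quadLp hz (μ, A) ∧
    (chaos1 hz).starProjection ((memLp_comp_of_hasLaw hz hh).toLp _) = quadLp hz (μ, 0) ∧
    (chaos2 hz).starProjection ((memLp_comp_of_hasLaw hz hh).toLp _) = quadLp hz (0, A) := by
  refine ⟨?_, ?_, ?_⟩
  · refine starProjection_eq_quadLp hz _ hh μ A ⟨_, rfl⟩ ?_
    rintro w ⟨⟨ν, B⟩, rfl⟩
    exact ⟨ν, B, rfl, by rw [hcov, integral_quadFun_mul_quadFun]⟩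
  · refine starProjection_eq_quadLp hz _ hh μ 0 ⟨μ, rfl⟩ ?_
    rintro w ⟨ν, rfl⟩
    exact ⟨ν, 0, rfl, by rw [hcov, integral_quadFun_mul_quadFun]; simp⟩
  · refine starProjection_eq_quadLp hz _ hh 0 A ⟨A, rfl⟩ ?_
    rintro w ⟨B, rfl⟩
    exact ⟨0, B, rfl, by rw [hcov, integral_quadFun_mul_quadFun]; simp⟩

/-- For the relative errors, `c` is the second moment of `ξ_{μ,A}`, `a` the squared error and `b`
its upper bound; `d` is the part of `c` that the smaller space misses, namely `0` or `‖μ‖²`. -/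
lemma div_add_le_div_add {a b c d : ℝ} (hac : 0 < c + a) (hab : a ≤ b)
    (hdc : d ≤ c) : (d + a) / (c + a) ≤ (d + b) / (c + b) := by
  rw [div_le_div_iff₀ hac (by linarith)]
  nlinarith

lemma integral_quadFun_comp_sq (hz : HasLaw z (stdGaussian (E n)) P) (ν : E n) (B : Mat n) :
    ∫ ω, quadFun ν B (z ω) ^ 2 ∂P = ‖ν‖ ^ 2 + 2 * frobSq (symPart B) := by
  rw [integral_comp_of_hasLaw hz (h := fun x => quadFun ν B x ^ 2)
    ((memLp_quadFun ν B).1.pow 2), integral_quadFun_sq]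

@[simp]
lemma symPart_zero : symPart (0 : Mat n) = 0 := by simp [symPart]

@[simp]
lemma frobSq_zero : frobSq (0 : Mat n) = 0 := by simp [frobSq]

lemma quadFun_sub (μ ν : E n) (A B : Mat n) (x : E n) :
    quadFun μ A x - quadFun ν B x = quadFun (μ - ν) (A - B) x := by
  have h := congrFun (quadFun_add (μ - ν) ν (A - B) B) x
  rw [sub_add_cancel, sub_add_cancel, Pi.add_apply] at h
  rw [h]
  ring

variable {f : E n → E n} {F : E n → Mat n} {ξ : Ω → ℝ} {μ : E n} {A : Mat n}

/-- The squared `L²` distance of `ξ` to `ξ_{ν,B}` when `E[ξ ξ_{ν,B}] = E[ξ_{ν,B}²]`. -/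
lemma integral_sub_quadFun_comp_sq (hz : HasLaw z (stdGaussian (E n)) P)
    (hf : IsGaussianSobolev f F) (hξ : ∀ ω, ξ ω = steinFun f F (z ω)) {ν : E n} {B : Mat n}
    (hcov : ∫ x, steinFun f F x * quadFun ν B x ∂(stdGaussian (E n)) =
      ‖ν‖ ^ 2 + 2 * frobSq (symPart B)) :
    ∫ ω, (ξ ω - quadFun ν B (z ω)) ^ 2 ∂P =
      ∫ ω, ξ ω ^ 2 ∂P - (‖ν‖ ^ 2 + 2 * frobSq (symPart B)) := by
  simp_rw [hξ]
  rw [integral_comp_of_hasLaw hz (h := fun x => (steinFun f F x - quadFun ν B x) ^ 2)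
      ((hf.memLp_steinFun.sub (memLp_quadFun ν B)).1.pow 2),
    integral_comp_of_hasLaw hz (h := fun x => steinFun f F x ^ 2) (hf.memLp_steinFun.1.pow 2),
    integral_sub_quadFun_sq hf.memLp_steinFun hcov]

lemma error_bounds [IsProbabilityMeasure P] (hz : HasLaw z (stdGaussian (E n)) P)
    (hf : IsGaussianSobolev f F) (hξ : ∀ ω, ξ ω = steinFun f F (z ω))
    (hμ : μ = meanVec P z f) (hA : A = meanMat P z F) :
      (∃ hL : MemLp ξ 2 P,
        (chaos12 hz).starProjection (hL.toLp ξ) = quadLp hz (μ, A) ∧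
        (chaos1 hz).starProjection (hL.toLp ξ) = quadLp hz (μ, 0) ∧
        (chaos2 hz).starProjection (hL.toLp ξ) = quadLp hz (0, A)) ∧
      (chaos1 hz).starProjection (quadLp hz (μ, A)) = quadLp hz (μ, 0) ∧
      (chaos2 hz).starProjection (quadLp hz (μ, A)) = quadLp hz (0, A) ∧
      (∫ ω, (ξ ω - quadFun μ A (z ω)) ^ 2 ∂P =
        (∫ ω, (‖f (z ω) - μ‖ ^ 2 - frobSq A) ∂P) +
          ∫ ω, ((F (z ω) - A) ^ 2).trace ∂P) ∧
      ((∫ ω, (‖f (z ω) - μ‖ ^ 2 - frobSq A) ∂P) +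
          ∫ ω, ((F (z ω) - A) ^ 2).trace ∂P ≤
        2 * ∫ ω, frobSq (symPart (F (z ω) - A)) ∂P) ∧
      (∫ ω, (quadFun μ A (z ω) - quadFun μ 0 (z ω)) ^ 2 ∂P =
        2 * frobSq (symPart A)) ∧
      (∫ ω, (quadFun μ A (z ω) - quadFun 0 A (z ω)) ^ 2 ∂P =
        ‖μ‖ ^ 2) ∧
      (0 < ∫ ω, ξ ω ^ 2 ∂P →
        relErrSq P ξ (fun ω => quadFun μ A (z ω)) ≤
          (2 * ∫ ω, frobSq (symPart (F (z ω) - A)) ∂P) /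
            (‖μ‖ ^ 2 + 2 * ∫ ω, frobSq (symPart (F (z ω))) ∂P) ∧
        relErrSq P ξ (fun ω => quadFun 0 A (z ω)) ≤
          (‖μ‖ ^ 2 + 2 * ∫ ω, frobSq (symPart (F (z ω) - A)) ∂P) /
            (‖μ‖ ^ 2 + 2 * ∫ ω, frobSq (symPart (F (z ω))) ∂P)) := by
  have hμ' : ∀ i, ∫ x, f x i ∂(stdGaussian (E n)) = μ i := fun i => by
    rw [hμ, meanVec_apply hz hf]
  have hA' : ∀ i j, ∫ x, F x i j ∂(stdGaussian (E n)) = A i j := fun i j => by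
    rw [hA, meanMat_apply hz hf]
  have hξ' : ξ = fun ω => steinFun f F (z ω) := funext hξ
  have t1 : ∫ ω, (‖f (z ω) - μ‖ ^ 2 - frobSq A) ∂P =
      ∫ x, (‖f x - μ‖ ^ 2 - frobSq A) ∂(stdGaussian (E n)) :=
    integral_comp_of_hasLaw hz (h := fun x => ‖f x - μ‖ ^ 2 - frobSq A)
      (hf.integral_norm_sub_sq hμ' _).1
  have t2 : ∫ ω, ((F (z ω) - A) ^ 2).trace ∂P =
      ∫ x, ((F x - A) ^ 2).trace ∂(stdGaussian (E n)) :=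
    integral_comp_of_hasLaw hz (h := fun x => ((F x - A) ^ 2).trace)
      (hf.integral_trace_sub_sq hA').1
  have t3 : ∫ ω, frobSq (symPart (F (z ω) - A)) ∂P =
      ∫ x, frobSq (symPart (F x - A)) ∂(stdGaussian (E n)) :=
    integral_comp_of_hasLaw hz (h := fun x => frobSq (symPart (F x - A)))
      (integrable_two_mul_frobSq_symPart (hf.memLp_sub_mean A)).1.1
  have t4 : ∫ ω, frobSq (symPart (F (z ω))) ∂P =
      ∫ x, frobSq (symPart (F x)) ∂(stdGaussian (E n)) :=
    integral_comp_of_hasLaw hz (h := fun x => frobSq (symPart (F x)))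
      (integrable_two_mul_frobSq_symPart hf.memLp_gradient).1.1
  have t5 : ∫ ω, (ξ ω - quadFun μ A (z ω)) ^ 2 ∂P =
      ∫ x, (steinFun f F x - quadFun μ A x) ^ 2 ∂(stdGaussian (E n)) := by
    simp_rw [hξ]
    exact integral_comp_of_hasLaw hz (h := fun x => (steinFun f F x - quadFun μ A x) ^ 2)
      ((hf.memLp_steinFun.sub (memLp_quadFun μ A)).1.pow 2)
  have hsub := integral_sub_quadFun_comp_sq hz hf hξ
    (hf.integral_steinFun_mul_quadFun_mean hμ' hA')
  have hle := hf.error_le hμ' hA'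
  have heq := hf.error_eq hμ' hA'
  have hsplit := hf.two_mul_integral_frobSq_symPart_sub hA'
  have hpos : 0 ≤ ∫ ω, (ξ ω - quadFun μ A (z ω)) ^ 2 ∂P := integral_nonneg fun _ => sq_nonneg _
  refine ⟨?_, ?_, ?_, ?_, ?_, ?_, ?_, fun h0 => ?_⟩
  · subst hξ'
    exact ⟨memLp_comp_of_hasLaw hz hf.memLp_steinFun, starProjection_chaos hz hf.memLp_steinFun μ A
      fun ν B => hf.integral_steinFun_mul_quadFun hμ' hA' ν B⟩
  · exact (starProjection_chaos hz (memLp_quadFun μ A) μ A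
      fun ν B => integral_quadFun_mul_quadFun μ ν A B).2.1
  · exact (starProjection_chaos hz (memLp_quadFun μ A) μ A
      fun ν B => integral_quadFun_mul_quadFun μ ν A B).2.2
  · rw [t1, t2, t5, heq]
  · rwa [t1, t2, t3]
  · simp_rw [quadFun_sub]
    rw [integral_quadFun_comp_sq hz]
    simp
  · simp_rw [quadFun_sub]
    rw [integral_quadFun_comp_sq hz]
    simp
  · set a := ∫ ω, (ξ ω - quadFun μ A (z ω)) ^ 2 ∂P with ha
    -- Pythagoras: `E[ξ²] = c + a`, while the denominator of the stated bounds equals `c + b`.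
    have hS : ∫ ω, ξ ω ^ 2 ∂P = ‖μ‖ ^ 2 + 2 * frobSq (symPart A) + a := by linarith
    have hab : a ≤ 2 * ∫ x, frobSq (symPart (F x - A)) ∂(stdGaussian (E n)) := by
      rw [t5, heq]
      exact hle
    have hfr := frobSq_nonneg (symPart A)
    have hden : ‖μ‖ ^ 2 + 2 * ∫ x, frobSq (symPart (F x)) ∂(stdGaussian (E n)) =
        ‖μ‖ ^ 2 + 2 * frobSq (symPart A) +
          2 * ∫ x, frobSq (symPart (F x - A)) ∂(stdGaussian (E n)) := by linarith
    simp only [relErrSq, integral_quadFun_comp_sq hz]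
    rw [t3, t4, hden, hS]
    rw [hS] at h0
    constructor
    · rw [one_sub_div h0.ne']
      have := div_add_le_div_add (d := 0) h0 hab (by positivity)
      simpa using this
    · rw [one_sub_div h0.ne']
      have := div_add_le_div_add (d := ‖μ‖ ^ 2) h0 hab (by linarith)
      convert this using 2
      simp
      ring

end Projection

end QuadApprox

namespace QuadApprox

/-! ### Characteristic functions of Gaussian quadratic forms -/

open Complex (I)

/-- The logarithm of the characteristic function at `t` of `ν x + l (x² - 1)`, for standard normal
`x`. -/
noncomputable def logCharQuad (t ν l : ℝ) : ℂ :=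
  -(1 / 2) * Complex.log (1 - 2 * t * l * I) - t * l * I -
    t ^ 2 * ν ^ 2 / (2 * (1 - 2 * t * l * I))

lemma one_sub_mul_I_ne_zero (t l : ℝ) : (1 - 2 * t * l * I : ℂ) ≠ 0 := by
  intro h
  have := congrArg Complex.re h
  simp at this

/-- Together with the density this is a Gaussian integral with complex parameter `w = 1 - 2tl i`.
Since `Re w = 1`, the integral converges and `w` avoids the branch cut, so the square root splits
through the principal logarithm. -/
lemma integral_cexp_quadratic_gaussianReal (t ν l : ℝ) :
    ∫ x, Complex.exp (t * (ν * x + l * (x ^ 2 - 1)) * I) ∂(gaussianReal 0 1) =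
      Complex.exp (logCharQuad t ν l) := by
  rw [integral_gaussianReal_eq_integral_smul (by norm_num)]
  set w : ℂ := 1 - 2 * t * l * I with hw
  have hw0 : w ≠ 0 := one_sub_mul_I_ne_zero t l
  have hre : w.re = 1 := by simp [hw]
  have hb : (-(w / 2)).re < 0 := by
    rw [Complex.neg_re, Complex.div_ofNat_re, hre]
    norm_num
  have h1 : ∀ x : ℝ, gaussianPDFReal 0 1 x •
      Complex.exp (t * (ν * x + l * (x ^ 2 - 1)) * I) =
      ((√(2 * Real.pi))⁻¹ : ℂ) *
        Complex.exp (-(w / 2) * x ^ 2 + (t * ν * I) * x + (-(t * l * I))) := by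
    intro x
    rw [gaussianPDFReal, Complex.real_smul]
    push_cast
    rw [mul_assoc, ← Complex.exp_add]
    simp only [mul_one, sub_zero]
    congr 2
    rw [hw]
    ring
  have h2 : ((2 * Real.pi : ℝ) : ℂ) = 2 * Real.pi := by push_cast; rfl
  have hpi : (0 : ℝ) < 2 * Real.pi := by positivity
  have harg : w.arg ≠ Real.pi := fun h => by
    have := Complex.arg_eq_pi_iff.1 h
    linarith [this.1]
  have h3 : ((Real.pi : ℂ) / -(-(w / 2))) ^ (1 / 2 : ℂ) =
      (√(2 * Real.pi) : ℂ) * Complex.exp (-(1 / 2) * Complex.log w) := by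
    have e : (Real.pi : ℂ) / -(-(w / 2)) = ((2 * Real.pi : ℝ) : ℂ) * w⁻¹ := by
      push_cast
      field_simp
    rw [e, Complex.cpow_def_of_ne_zero (mul_ne_zero (by simp [Real.pi_ne_zero]) (inv_ne_zero hw0)),
      Complex.log_ofReal_mul hpi (inv_ne_zero hw0), Complex.log_inv _ harg, add_mul,
      Complex.exp_add]
    congr 1
    · rw [Real.sqrt_eq_rpow, Real.rpow_def_of_pos hpi]
      push_cast
      rfl
    · congr 1
      ring
  have hs : (√(2 * Real.pi) : ℂ) ≠ 0 := Complex.ofReal_ne_zero.2 (Real.sqrt_pos.2 hpi).ne'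
  simp_rw [h1]
  rw [integral_const_mul, integral_cexp_quadratic hb, h3, mul_assoc, inv_mul_cancel_left₀ hs,
    ← Complex.exp_add]
  congr 1
  have h4 : (t * ν * I) ^ 2 / (4 * -(w / 2)) = (t : ℂ) ^ 2 * ν ^ 2 / (2 * w) := by
    rw [mul_pow, Complex.I_sq]
    field_simp
    ring
  rw [logCharQuad, ← hw, h4]
  ring

/-! ### Diagonalization -/

section Diagonalize

variable {n : ℕ}

lemma symPart_isHermitian (A : Mat n) : (symPart A).IsHermitian := by
  ext i j
  simp [symPart]
  ring

lemma quadFun_symPart (ν : E n) (A : Mat n) : quadFun ν (symPart A) = quadFun ν A := by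
  funext x
  have h1 : (symPart A).trace = A.trace := by
    simp [symPart, Matrix.trace_add]
    ring
  have h2 : inner ℝ x (Matrix.toEuclideanCLM (n := Fin n) (𝕜 := ℝ) (symPart A) x) =
      inner ℝ x (Matrix.toEuclideanCLM (n := Fin n) (𝕜 := ℝ) A x) := by
    simp only [PiLp.inner_apply, toEuclideanCLM_apply_coord, symPart, Matrix.smul_apply,
      Matrix.add_apply, Matrix.transpose_apply, smul_eq_mul, RCLike.inner_apply, conj_trivial,
      Finset.sum_mul]
    have : ∀ i j, 1 / 2 * (A i j + A j i) * x j * x i =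
        (1 / 2) * (A i j * x j * x i) + (1 / 2) * (A j i * x i * x j) := fun i j => by ring
    simp_rw [this, Finset.sum_add_distrib, ← Finset.mul_sum]
    rw [Finset.sum_comm (f := fun i j => A j i * x i * x j)]
    ring
  simp only [quadFun, inner_add_right, h1, h2]

/-- A Gaussian quadratic polynomial has the law of a sum of independent one-dimensional ones, the
coefficients of the squares being the eigenvalues of the symmetric part of the matrix. -/
lemma exists_charFun_quadFun (ν : E n) (A : Mat n) :
    ∃ c l : Fin n → ℝ, (∀ t : ℝ, ∫ x, Complex.exp (t * quadFun ν A x * I) ∂(stdGaussian (E n)) =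
        Complex.exp (∑ i, logCharQuad t (c i) (l i))) ∧
      ∑ i, c i ^ 2 = ‖ν‖ ^ 2 ∧ ∑ i, l i ^ 2 = frobSq (symPart A) ∧
      (∀ i, |l i| ≤ opNorm (symPart A)) ∧
      ∀ η, 0 ≤ η → (∀ i, |l i| ≤ η) → opNorm (symPart A) ≤ η := by
  set S := symPart A with hS
  have hH : S.IsHermitian := symPart_isHermitian A
  set b := hH.eigenvectorBasis
  set l := hH.eigenvalues
  set T := Matrix.toEuclideanCLM (n := Fin n) (𝕜 := ℝ) S with hT
  have hTb : ∀ i, T (b i) = l i • b i := by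
    intro i
    have := hH.mulVec_eigenvectorBasis i
    ext j
    have h := congrFun this j
    rw [hT, Matrix.ofLp_toEuclideanCLM]
    simpa using h
  have hsymm : ∀ x y, inner ℝ (T x) y = inner ℝ x (T y) := by
    intro x y
    simp only [hT, PiLp.inner_apply, toEuclideanCLM_apply_coord, RCLike.inner_apply, conj_trivial,
      Finset.sum_mul, Finset.mul_sum]
    rw [Finset.sum_comm]
    refine Finset.sum_congr rfl fun i _ => Finset.sum_congr rfl fun j _ => ?_
    have : S j i = S i j := by simpa using hH.apply i j
    rw [this]
    ring
  have hinner : ∀ i x, inner ℝ (b i) (T x) = l i * inner ℝ (b i) x := by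
    intro i x
    rw [← hsymm, hTb, real_inner_smul_left]
  have hnormT : ∀ x, ‖T x‖ ^ 2 = ∑ i, l i ^ 2 * inner ℝ (b i) x ^ 2 := by
    intro x
    rw [← b.sum_sq_inner_right]
    simp_rw [hinner, mul_pow]
  -- The linear coefficients are the coordinates of `ν` in the eigenbasis. In these coordinates the
  -- polynomial separates, and the Gaussian measure is still a product measure.
  refine ⟨fun i => inner ℝ (b i) ν, l, fun t => ?_, b.sum_sq_inner_right ν, ?_, fun i => ?_,
    fun η hη hl => ?_⟩
  · have hq : ∀ x : Fin n → ℝ, quadFun ν A (∑ i, x i • b i) =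
        ∑ i, (inner ℝ (b i) ν * x i + l i * (x i ^ 2 - 1)) := by
      intro x
      rw [← quadFun_symPart, quadFun, inner_add_right, ← hS, ← hT, map_sum]
      simp_rw [map_smul, hTb, smul_smul]
      rw [sum_inner, b.orthonormal.inner_sum, hH.trace_eq_sum_eigenvalues]
      simp_rw [real_inner_smul_left]
      rw [← Finset.sum_add_distrib, ← Finset.sum_sub_distrib]
      refine Finset.sum_congr rfl fun i _ => ?_
      simp
      ring
    have hc : Continuous (quadFun ν A) := by
      unfold quadFun
      fun_prop
    rw [stdGaussian_eq_map_pi_orthonormalBasis b, integral_map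
      (Measurable.aemeasurable (by fun_prop))
      (Continuous.aestronglyMeasurable (by fun_prop))]
    simp_rw [hq]
    have : ∀ x : Fin n → ℝ, Complex.exp (t * ((∑ i, (inner ℝ (b i) ν * x i +
        l i * (x i ^ 2 - 1)) : ℝ) : ℂ) * I) =
        ∏ i, Complex.exp (t * ((inner ℝ (b i) ν : ℝ) * x i + l i * (x i ^ 2 - 1)) * I) := by
      intro x
      rw [← Complex.exp_sum, Complex.ofReal_sum, Finset.mul_sum, Finset.sum_mul]
      push_cast
      rfl
    simp_rw [this]
    rw [integral_fintype_prod_eq_prod (f := fun i (x : ℝ) =>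
      Complex.exp (t * ((inner ℝ (b i) ν : ℝ) * x + l i * (x ^ 2 - 1)) * I)), Complex.exp_sum]
    simp_rw [integral_cexp_quadratic_gaussianReal]
  -- The squared Frobenius norm is `∑ ‖S eⱼ‖²`; Parseval in the eigenbasis and then in the standard
  -- basis turns it into the sum of squared eigenvalues.
  · have h1 : ∀ j, ‖T (EuclideanSpace.single j 1)‖ ^ 2 = ∑ i, S i j ^ 2 := by
      intro j
      rw [EuclideanSpace.real_norm_sq_eq]
      simp [hT, toEuclideanCLM_apply_coord]
    have h2 : ∀ i, ∑ j, inner ℝ (b i) (EuclideanSpace.single j (1 : ℝ)) ^ 2 = 1 := by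
      intro i
      have := (EuclideanSpace.basisFun (Fin n) ℝ).sum_sq_inner_left (b i)
      simpa using this
    rw [frobSq, Finset.sum_comm]
    simp_rw [← h1, hnormT]
    rw [Finset.sum_comm]
    simp_rw [← Finset.mul_sum, h2, mul_one]
  · have := T.le_opNorm (b i)
    rw [hTb, norm_smul, b.norm_eq_one, mul_one, mul_one] at this
    exact this
  · refine T.opNorm_le_bound hη fun x => ?_
    refine abs_le_of_sq_le_sq' ?_ (by positivity) |>.2
    rw [hnormT, mul_pow, ← b.sum_sq_inner_right x, Finset.mul_sum]
    refine Finset.sum_le_sum fun i _ => ?_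
    gcongr ?_ * _
    rw [← sq_abs]
    exact pow_le_pow_left₀ (abs_nonneg _) (hl i) 2

end Diagonalize

end QuadApprox

namespace QuadApprox

open Complex (I)

/-! ### Limits of the characteristic functions -/

lemma norm_log_one_sub_add_le {w : ℂ} (hw : ‖w‖ ≤ 1 / 2) :
    ‖Complex.log (1 - w) + w + w ^ 2 / 2‖ ≤ ‖w‖ ^ 3 * (2 / 3) := by
  have hlt : ‖-w‖ < 1 := by rw [norm_neg]; linarith
  have h := Complex.norm_log_sub_logTaylor_le 2 hlt
  have e : Complex.log (1 + -w) - Complex.logTaylor (2 + 1) (-w) =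
      Complex.log (1 - w) + w + w ^ 2 / 2 := by
    simp [Complex.logTaylor_succ, Complex.logTaylor_zero]
    ring_nf
  rw [e, norm_neg] at h
  refine h.trans ?_
  have h2 : (1 - ‖w‖)⁻¹ ≤ 2 := by
    rw [inv_le_comm₀ (by linarith) (by norm_num)]
    linarith
  calc ‖w‖ ^ (2 + 1) * (1 - ‖w‖)⁻¹ / ((2 : ℕ) + 1) ≤ ‖w‖ ^ (2 + 1) * 2 / ((2 : ℕ) + 1) := by
        gcongr
    _ = _ := by push_cast; ring

/-- With `w = 2tl i`, the linear term of `log (1 - w)` cancels `-tl i` and the quadratic term gives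
`-t² l²`. The rest is a cubic Taylor remainder and `w (1 - w)⁻¹` times `t² c²/2`, both with a factor
`|l|`. The bound `1/4` ensures `‖w‖ ≤ 1/2`. -/
lemma norm_logCharQuad_add_le {t c l : ℝ} (h : |t * l| ≤ 1 / 4) :
    ‖logCharQuad t c l + ((t ^ 2 / 2 * (c ^ 2 + 2 * l ^ 2) : ℝ) : ℂ)‖ ≤
      2 * |t| ^ 3 * |l| * (c ^ 2 + 2 * l ^ 2) := by
  set w : ℂ := 2 * t * l * I with hw
  have hwn : ‖w‖ = 2 * (|t| * |l|) := by
    simp [hw, mul_assoc]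
  rw [abs_mul] at h
  have hw2 : ‖w‖ ≤ 1 / 2 := by linarith
  have h0 : (1 - w : ℂ) ≠ 0 := one_sub_mul_I_ne_zero t l
  have hinv : ‖(1 - w)⁻¹‖ ≤ 2 := by
    rw [norm_inv, inv_le_comm₀ (norm_pos_iff.2 h0) (by norm_num)]
    have := norm_sub_norm_le (1 : ℂ) w
    rw [norm_one] at this
    linarith
  have hsq : w ^ 2 = -(4 * t ^ 2 * l ^ 2) := by
    rw [hw]
    ring_nf
    rw [Complex.I_sq]
    ring
  have e : logCharQuad t c l + ((t ^ 2 / 2 * (c ^ 2 + 2 * l ^ 2) : ℝ) : ℂ) =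
      -(1 / 2) * (Complex.log (1 - w) + w + w ^ 2 / 2) -
        ((t ^ 2 * c ^ 2 / 2 : ℝ) : ℂ) * (w * (1 - w)⁻¹) := by
    have hi : w * (1 - w)⁻¹ = (1 - w)⁻¹ - 1 := by
      field_simp
      ring
    rw [hi, hsq, logCharQuad, ← hw, div_mul_eq_div_div, div_eq_mul_inv _ (1 - w)]
    push_cast
    linear_combination (1 / 2) * hw
  rw [e]
  refine (norm_sub_le _ _).trans ?_
  rw [norm_mul, norm_mul, norm_mul, Complex.norm_real, Real.norm_of_nonneg (by positivity)]
  have hh : ‖(-(1 / 2) : ℂ)‖ = 1 / 2 := by norm_num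
  rw [hh]
  calc 1 / 2 * ‖Complex.log (1 - w) + w + w ^ 2 / 2‖ + t ^ 2 * c ^ 2 / 2 * (‖w‖ * ‖(1 - w)⁻¹‖)
      ≤ 1 / 2 * (‖w‖ ^ 3 * (2 / 3)) + t ^ 2 * c ^ 2 / 2 * (‖w‖ * 2) := by
        gcongr
        exact norm_log_one_sub_add_le hw2
    _ = |t| ^ 3 * |l| * (8 / 3 * l ^ 2 + 2 * c ^ 2) := by
        rw [hwn, ← sq_abs t, ← sq_abs l]
        ring
    _ ≤ _ := by
        rw [show 2 * |t| ^ 3 * |l| * (c ^ 2 + 2 * l ^ 2) =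
          |t| ^ 3 * |l| * (4 * l ^ 2 + 2 * c ^ 2) by ring]
        gcongr
        norm_num

/-- One factor `|lᵢ|` is replaced by the maximum, and what remains sums to the variance, so the
bound does not involve the dimension. -/
lemma norm_sum_logCharQuad_add_le {ι : Type*} [Fintype ι] {t m : ℝ} {c l : ι → ℝ}
    (hl : ∀ i, |l i| ≤ m) (hm : |t| * m ≤ 1 / 4) :
    ‖∑ i, logCharQuad t (c i) (l i) +
        ((t ^ 2 / 2 * (∑ i, c i ^ 2 + 2 * ∑ i, l i ^ 2) : ℝ) : ℂ)‖ ≤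
      2 * |t| ^ 3 * m * (∑ i, c i ^ 2 + 2 * ∑ i, l i ^ 2) := by
  rw [Finset.mul_sum, ← Finset.sum_add_distrib, Finset.mul_sum, Finset.mul_sum,
    Complex.ofReal_sum, ← Finset.sum_add_distrib]
  refine norm_sum_le_of_le _ fun i _ => ?_
  have h1 : |t * l i| ≤ 1 / 4 := by
    rw [abs_mul]
    exact (mul_le_mul_of_nonneg_left (hl i) (abs_nonneg t)).trans hm
  refine (norm_logCharQuad_add_le h1).trans ?_
  gcongr
  exact hl i

lemma tendsto_exp_sum_logCharQuad {n : ℕ → ℕ} {c l : ∀ k, Fin (n k) → ℝ} {m : ℕ → ℝ}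
    (hl : ∀ k i, |l k i| ≤ m k) (hm : Tendsto m atTop (𝓝 0))
    (hv : Tendsto (fun k => ∑ i, c k i ^ 2 + 2 * ∑ i, l k i ^ 2) atTop (𝓝 1)) (t : ℝ) :
    Tendsto (fun k => Complex.exp (∑ i, logCharQuad t (c k i) (l k i))) atTop
      (𝓝 (Complex.exp (-((t ^ 2 / 2 : ℝ) : ℂ)))) := by
  refine (Complex.continuous_exp.tendsto _).comp ?_
  set v := fun k => ∑ i, c k i ^ 2 + 2 * ∑ i, l k i ^ 2 with hvdef
  have h1 : Tendsto (fun k => ∑ i, logCharQuad t (c k i) (l k i) +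
      ((t ^ 2 / 2 * v k : ℝ) : ℂ)) atTop (𝓝 0) := by
    have hb : Tendsto (fun k => 2 * |t| ^ 3 * m k * v k) atTop (𝓝 0) := by
      simpa using (hm.const_mul (2 * |t| ^ 3)).mul hv
    refine squeeze_zero_norm' ?_ hb
    have : ∀ᶠ k in atTop, |t| * m k < 1 / 4 := by
      have := hm.const_mul |t|
      rw [mul_zero] at this
      exact this.eventually_lt_const (by norm_num)
    filter_upwards [this] with k hk
    exact norm_sum_logCharQuad_add_le (hl k) hk.le
  have h2 : Tendsto (fun k => ((t ^ 2 / 2 * v k : ℝ) : ℂ)) atTop (𝓝 ((t ^ 2 / 2 : ℝ) : ℂ)) := by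
    refine (Complex.continuous_ofReal.tendsto _).comp ?_
    simpa using hv.const_mul (t ^ 2 / 2)
  simpa using h1.sub h2

/-- The rate at which `∑ (νᵢ xᵢ + lᵢ (xᵢ² - 1))` departs from normality. -/
noncomputable def logDefect (x : ℝ) : ℝ := x - 1 / 4 * Real.log (1 + 4 * x)

lemma logDefect_lt {x y : ℝ} (hx : 0 ≤ x) (hxy : x < y) : logDefect x < logDefect y := by
  have h1 : 0 < 1 + 4 * x := by linarith
  have h2 : 0 < 1 + 4 * y := by linarith
  have h := Real.log_lt_sub_one_of_pos (div_pos h2 h1) (by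
    rw [Ne, div_eq_one_iff_eq h1.ne']
    intro h
    linarith)
  rw [Real.log_div h2.ne' h1.ne', div_sub_one h1.ne'] at h
  have : (1 + 4 * y - (1 + 4 * x)) / (1 + 4 * x) ≤ 1 + 4 * y - (1 + 4 * x) :=
    div_le_self (by linarith) (by linarith)
  unfold logDefect
  linarith

lemma logDefect_nonneg {x : ℝ} (hx : 0 ≤ x) : 0 ≤ logDefect x := by
  rcases hx.eq_or_lt with rfl | h
  · simp [logDefect]
  · have := logDefect_lt le_rfl h
    simp only [logDefect, mul_zero, add_zero, Real.log_one, sub_zero] at this ⊢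
    exact this.le

/-- The modulus `|1 - 2l i|² = 1 + 4l²` gives the logarithm exactly. The linear part contributes
`(c²/2)(1 - (1 + 4l²)⁻¹) ≥ 0`, which is dropped. -/
lemma logDefect_le_re_logCharQuad (c l : ℝ) :
    logDefect (l ^ 2) ≤ (logCharQuad 1 c l).re + (c ^ 2 + 2 * l ^ 2) / 2 := by
  have hn : Complex.normSq (1 - 2 * l * I) = 1 + 4 * l ^ 2 := by
    rw [Complex.normSq_apply]
    simp
    ring
  have hpos : (0 : ℝ) < 1 + 4 * l ^ 2 := by positivity
  have h1 : (Complex.log (1 - 2 * l * I)).re = 1 / 2 * Real.log (1 + 4 * l ^ 2) := by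
    rw [Complex.log_re, Complex.norm_def, hn, Real.log_sqrt hpos.le]
    ring
  have h2 : ((c : ℂ) ^ 2 / (2 * (1 - 2 * l * I))).re = c ^ 2 / 2 * (1 + 4 * l ^ 2)⁻¹ := by
    have : (c : ℂ) ^ 2 / (2 * (1 - 2 * l * I)) = ((c ^ 2 / 2 : ℝ) : ℂ) * (1 - 2 * l * I)⁻¹ := by
      push_cast
      rw [div_mul_eq_div_div, div_eq_mul_inv]
    rw [this, Complex.re_ofReal_mul, Complex.inv_re, hn]
    simp
  have e : (logCharQuad 1 c l).re =
      -(1 / 2) * (1 / 2 * Real.log (1 + 4 * l ^ 2)) - c ^ 2 / 2 * (1 + 4 * l ^ 2)⁻¹ := by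
    rw [← h1, ← h2, logCharQuad]
    have : (-(1 / 2) : ℂ) = ((-(1 / 2) : ℝ) : ℂ) := by push_cast; rfl
    simp only [Complex.ofReal_one, mul_one, one_pow, one_mul, Complex.sub_re]
    rw [this, Complex.re_ofReal_mul]
    simp
  have h3 : c ^ 2 / 2 * (1 + 4 * l ^ 2)⁻¹ ≤ c ^ 2 / 2 :=
    mul_le_of_le_one_right (by positivity) (inv_le_one_of_one_le₀ (by nlinarith [sq_nonneg l]))
  rw [e, logDefect]
  linarith

lemma logDefect_le_re_sum_logCharQuad {ι : Type*} [Fintype ι] (c l : ι → ℝ) (j : ι) :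
    logDefect (l j ^ 2) ≤ (∑ i, logCharQuad 1 (c i) (l i)).re +
      (∑ i, c i ^ 2 + 2 * ∑ i, l i ^ 2) / 2 := by
  rw [Complex.re_sum, Finset.mul_sum, ← Finset.sum_add_distrib, Finset.sum_div,
    ← Finset.sum_add_distrib]
  refine le_trans ?_ (Finset.sum_le_sum fun i _ => logDefect_le_re_logCharQuad (c i) (l i))
  exact Finset.single_le_sum (f := fun i => logDefect (l i ^ 2))
    (fun i _ => logDefect_nonneg (sq_nonneg _)) (Finset.mem_univ j)

/-- The modulus at `t = 1` suffices: its logarithm tends to `-1/2` and half the variance to `1/2`,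
so the total defect tends to zero. All defects are nonnegative, so each `logDefect (lᵢ²)` is small,
and strict monotonicity bounds `|lᵢ|` uniformly in `i`. -/
lemma eventually_forall_abs_le_of_tendsto {n : ℕ → ℕ} {c l : ∀ k, Fin (n k) → ℝ}
    (hv : Tendsto (fun k => ∑ i, c k i ^ 2 + 2 * ∑ i, l k i ^ 2) atTop (𝓝 1))
    (h : Tendsto (fun k => Complex.exp (∑ i, logCharQuad 1 (c k i) (l k i))) atTop
      (𝓝 (Complex.exp (-((1 ^ 2 / 2 : ℝ) : ℂ))))) {η : ℝ} (hη : 0 < η) :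
    ∀ᶠ k in atTop, ∀ i, |l k i| ≤ η := by
  have h1 : Tendsto (fun k => (∑ i, logCharQuad 1 (c k i) (l k i)).re) atTop (𝓝 (-(1 / 2))) := by
    have := h.norm.log (by simp)
    simp only [Complex.norm_exp, Real.log_exp] at this
    simpa using this
  have h2 := h1.add (hv.div_const 2)
  rw [neg_add_cancel] at h2
  have hpos : 0 < logDefect (η ^ 2) :=
    (logDefect_nonneg le_rfl).trans_lt (logDefect_lt le_rfl (by positivity))
  filter_upwards [h2.eventually_lt_const hpos] with k hk i
  by_contra hlt
  push Not at hlt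
  have h3 : η ^ 2 < l k i ^ 2 := by
    rw [← sq_abs (l k i)]
    exact pow_lt_pow_left₀ hlt hη.le two_ne_zero
  have h4 := logDefect_lt (sq_nonneg η) h3
  have h5 := logDefect_le_re_sum_logCharQuad (c k) (l k) i
  linarith

/-- A sequence of Gaussian quadratic polynomials with variances tending to `1` is asymptotically
normal if and only if the operator norms of the quadratic parts tend to zero. -/
lemma tendsto_charFun_quadFun_iff {n : ℕ → ℕ} {ν : ∀ k, E (n k)} {A : ∀ k, Mat (n k)}
    (hv : Tendsto (fun k => ‖ν k‖ ^ 2 + 2 * frobSq (symPart (A k))) atTop (𝓝 1)) :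
    (∀ t : ℝ, Tendsto (fun k => ∫ x, Complex.exp (t * quadFun (ν k) (A k) x * I)
        ∂(stdGaussian (E (n k)))) atTop (𝓝 (Complex.exp (-((t ^ 2 / 2 : ℝ) : ℂ))))) ↔
      Tendsto (fun k => opNorm (symPart (A k))) atTop (𝓝 0) := by
  choose c l hchar hc hl hle hop using fun k => exists_charFun_quadFun (ν k) (A k)
  simp_rw [hchar]
  simp_rw [← hc, ← hl] at hv
  refine ⟨fun h => ?_, fun h => tendsto_exp_sum_logCharQuad hle h hv⟩
  rw [Metric.tendsto_atTop']
  intro ε hε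
  obtain ⟨N, hN⟩ := eventually_atTop.1
    (eventually_forall_abs_le_of_tendsto hv (by simpa using h 1) (half_pos hε))
  refine ⟨N, fun k hk => ?_⟩
  have h0 : 0 ≤ opNorm (symPart (A k)) := norm_nonneg _
  rw [Real.dist_0_eq_abs, abs_of_nonneg h0]
  linarith [hop k (ε / 2) (half_pos hε).le (hN k hk.le)]

end QuadApprox

namespace QuadApprox

open Complex (I)

/-! ### Asymptotic normality -/

section CharFun

variable {Ω : Type*} [MeasurableSpace Ω] {P : Measure Ω} [IsProbabilityMeasure P]

lemma integral_abs_le_sqrt {X : Ω → ℝ} (hX : MemLp X 2 P) :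
    ∫ ω, |X ω| ∂P ≤ √(∫ ω, X ω ^ 2 ∂P) := by
  refine Real.le_sqrt_of_sq_le ?_
  have h := variance_nonneg (fun ω => ‖X ω‖) P
  rw [variance_eq_sub hX.norm] at h
  simpa using h

lemma integrable_cexp_mul_I {X : Ω → ℝ} (hX : AEMeasurable X P) (t : ℝ) :
    Integrable (fun ω => Complex.exp (t * X ω * I)) P := by
  refine Integrable.of_bound (C := 1) ?_ (ae_of_all _ fun ω => ?_)
  · exact (by fun_prop : AEMeasurable (fun ω => Complex.exp (t * X ω * I)) P).aestronglyMeasurable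
  · rw [← Complex.ofReal_mul, Complex.norm_exp_ofReal_mul_I]

/-- The function `x ↦ exp(itx)` is `|t|`-Lipschitz, and the `L¹` distance is at most the `L²`
distance. -/
lemma norm_integral_cexp_sub_le {X Y : Ω → ℝ} (hX : MemLp X 2 P) (hY : MemLp Y 2 P) (t : ℝ) :
    ‖∫ ω, Complex.exp (t * X ω * I) ∂P - ∫ ω, Complex.exp (t * Y ω * I) ∂P‖ ≤
      |t| * √(∫ ω, (X ω - Y ω) ^ 2 ∂P) := by
  have hpt : ∀ x y : ℝ, ‖Complex.exp (t * x * I) - Complex.exp (t * y * I)‖ ≤ |t| * |x - y| := by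
    intro x y
    have e : Complex.exp (t * x * I) - Complex.exp (t * y * I) =
        Complex.exp ((t * y : ℝ) * I) * (Complex.exp (I * (t * (x - y) : ℝ)) - 1) := by
      rw [mul_sub, ← Complex.exp_add, mul_one]
      push_cast
      congr 2
      ring
    rw [e, norm_mul, Complex.norm_exp_ofReal_mul_I, one_mul, ← abs_mul]
    exact Real.norm_exp_I_mul_ofReal_sub_one_le
  rw [← integral_sub (integrable_cexp_mul_I hX.1.aemeasurable t)
    (integrable_cexp_mul_I hY.1.aemeasurable t)]
  refine (norm_integral_le_of_norm_le (((hX.sub hY).integrable one_le_two).abs.const_mul |t|)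
    (ae_of_all _ fun ω => hpt (X ω) (Y ω))).trans ?_
  rw [integral_const_mul]
  exact mul_le_mul_of_nonneg_left (integral_abs_le_sqrt (hX.sub hY)) (abs_nonneg t)

end CharFun

/-- Lévy's continuity theorem, applied to the laws on `ℝ` because the probability spaces vary with
`k`. -/
lemma tendstoInDistribution_gaussianReal_iff {Ω : ℕ → Type*} [∀ k, MeasurableSpace (Ω k)]
    {P : ∀ k, Measure (Ω k)} [∀ k, IsProbabilityMeasure (P k)] {X : ∀ k, Ω k → ℝ}
    (hX : ∀ k, AEMeasurable (X k) (P k)) :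
    TendstoInDistribution X atTop (id : ℝ → ℝ) P (gaussianReal 0 1) ↔
      ∀ t : ℝ, Tendsto (fun k => ∫ ω, Complex.exp (t * X k ω * I) ∂(P k)) atTop
        (𝓝 (Complex.exp (-((t ^ 2 / 2 : ℝ) : ℂ)))) := by
  let Q : ℕ → ProbabilityMeasure ℝ :=
    fun k => ⟨(P k).map (X k), Measure.isProbabilityMeasure_map (hX k)⟩
  let Q₀ : ProbabilityMeasure ℝ :=
    ⟨(gaussianReal 0 1).map id, Measure.isProbabilityMeasure_map aemeasurable_id⟩
  have h1 : TendstoInDistribution X atTop (id : ℝ → ℝ) P (gaussianReal 0 1) ↔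
      Tendsto Q atTop (𝓝 Q₀) := ⟨fun h => h.tendsto, fun h => ⟨hX, aemeasurable_id, h⟩⟩
  rw [h1, ProbabilityMeasure.tendsto_iff_tendsto_charFun]
  refine forall_congr' fun t => ?_
  have h2 : charFun (Q₀ : Measure ℝ) t = Complex.exp (-((t ^ 2 / 2 : ℝ) : ℂ)) := by
    rw [ProbabilityMeasure.coe_mk, Measure.map_id, charFun_gaussianReal]
    congr 1
    push_cast
    ring
  have h3 : ∀ k, charFun (Q k : Measure ℝ) t = ∫ ω, Complex.exp (t * X k ω * I) ∂(P k) := by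
    intro k
    rw [ProbabilityMeasure.coe_mk, charFun_apply_real, integral_map (hX k)
      (Continuous.aestronglyMeasurable (by fun_prop))]
  simp only [h2, h3]

section Scale

variable {n : ℕ}

lemma symPart_smul (r : ℝ) (A : Mat n) : symPart (r • A) = r • symPart A := by
  simp [symPart, smul_comm r]

lemma frobSq_smul (r : ℝ) (A : Mat n) : frobSq (r • A) = r ^ 2 * frobSq A := by
  simp [frobSq, mul_pow, Finset.mul_sum]

lemma opNorm_smul (r : ℝ) (A : Mat n) : opNorm (r • A) = |r| * opNorm A := by
  rw [opNorm, map_smul, norm_smul, Real.norm_eq_abs, opNorm]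

end Scale

lemma IsGaussianSobolev.variance_comp {Ω : Type*} [MeasurableSpace Ω] {P : Measure Ω}
    [IsProbabilityMeasure P] {n : ℕ} {z : Ω → E n} {f : E n → E n} {F : E n → Mat n} {ξ : Ω → ℝ}
    (hz : HasLaw z (stdGaussian (E n)) P) (hf : IsGaussianSobolev f F)
    (hξ : ∀ ω, ξ ω = steinFun f F (z ω)) : MemLp ξ 2 P ∧ Var[ξ; P] = ∫ ω, ξ ω ^ 2 ∂P := by
  have h1 : ξ = fun ω => steinFun f F (z ω) := funext hξ
  have h2 : MemLp ξ 2 P := h1 ▸ memLp_comp_of_hasLaw hz hf.memLp_steinFun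
  refine ⟨h2, variance_of_integral_eq_zero h2.1.aemeasurable ?_⟩
  rw [h1, integral_comp_of_hasLaw hz hf.memLp_steinFun.1, hf.integral_steinFun]

/-- Used with `d = ‖ν‖² + ‖Bˢ‖_F²`, `a` the variance of the approximation and `V` that of `ξ`: these
are comparable up to a factor two, so any of them may normalize the squared operator norm. -/
lemma tendsto_div_iff {ι : Type*} {l : Filter ι} {x a d V : ι → ℝ}
    (hx : ∀ k, 0 ≤ x k) (hV : ∀ᶠ k in l, 0 < V k)
    (hda : ∀ k, d k ≤ a k) (had : ∀ k, a k ≤ 2 * d k)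
    (h : Tendsto (fun k => a k / V k) l (𝓝 1)) :
    Tendsto (fun k => x k / d k) l (𝓝 0) ↔ Tendsto (fun k => x k / V k) l (𝓝 0) := by
  have hpos : ∀ᶠ k in l, 0 < V k ∧ 0 < d k ∧ 0 < a k := by
    filter_upwards [hV, h.eventually_const_lt one_pos] with k h1 h2
    have h3 : 0 < a k := (div_pos_iff_of_pos_right h1).1 h2
    exact ⟨h1, by linarith [had k], h3⟩
  constructor
  · intro hd
    have h0 := hd.mul h
    rw [zero_mul] at h0
    refine squeeze_zero' (hpos.mono fun k hk => div_nonneg (hx k) hk.1.le) ?_ h0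
    filter_upwards [hpos] with k ⟨h1, h2, h3⟩
    rw [div_mul_div_comm, div_le_div_iff₀ h1 (by positivity)]
    have := mul_le_mul_of_nonneg_left (hda k) (mul_nonneg (hx k) h1.le)
    linarith
  · intro hd
    have h0 := (hd.div h one_ne_zero).const_mul 2
    rw [zero_div, mul_zero] at h0
    refine squeeze_zero' (hpos.mono fun k hk => div_nonneg (hx k) hk.2.1.le) ?_ h0
    filter_upwards [hpos] with k ⟨h1, h2, h3⟩
    rw [Pi.div_apply, div_div_div_cancel_right₀ h1.ne', ← mul_div_assoc, div_le_div_iff₀ h2 h3]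
    have := mul_le_mul_of_nonneg_left (had k) (hx k)
    linarith

/-- Asymptotic normality of `ξ` when `ξ` is equivalent in `L²` to a quadratic polynomial
`ξ_{ν,B}` with `E[ξ ξ_{ν,B}] = E[ξ_{ν,B}²]`. -/
lemma tendsto_opNorm_iff_tendstoInDistribution {Ω : ℕ → Type*} [∀ k, MeasurableSpace (Ω k)]
    {P : ∀ k, Measure (Ω k)} [∀ k, IsProbabilityMeasure (P k)]
    {n : ℕ → ℕ} {z : ∀ k, Ω k → E (n k)}
    (hz : ∀ k, HasLaw (z k) (stdGaussian (E (n k))) (P k))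
    {f : ∀ k, E (n k) → E (n k)} {F : ∀ k, E (n k) → Mat (n k)}
    (hf : ∀ k, IsGaussianSobolev (f k) (F k))
    {ξ : ∀ k, Ω k → ℝ} (hξ : ∀ k ω, ξ k ω = steinFun (f k) (F k) (z k ω))
    {ν : ∀ k, E (n k)} {B : ∀ k, Mat (n k)}
    (hcov : ∀ k, ∫ x, steinFun (f k) (F k) x * quadFun (ν k) (B k) x ∂(stdGaussian (E (n k))) =
      ‖ν k‖ ^ 2 + 2 * frobSq (symPart (B k)))
    (hvar : ∀ᶠ k in atTop, 0 < Var[ξ k; P k])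
    (hrel : Tendsto (fun k => relErrSq (P k) (ξ k) (fun ω => quadFun (ν k) (B k) (z k ω)))
      atTop (𝓝 0)) :
    Tendsto (fun k => opNorm (symPart (B k)) ^ 2 / (‖ν k‖ ^ 2 + frobSq (symPart (B k))))
        atTop (𝓝 0) ↔
      TendstoInDistribution (fun k ω => ξ k ω / √(Var[ξ k; P k]))
        atTop (id : ℝ → ℝ) P (gaussianReal 0 1) := by
  have hL : ∀ k, MemLp (ξ k) 2 (P k) := fun k => ((hf k).variance_comp (hz k) (hξ k)).1
  have hvareq : ∀ k, ∫ ω, ξ k ω ^ 2 ∂(P k) = Var[ξ k; P k] :=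
    fun k => ((hf k).variance_comp (hz k) (hξ k)).2.symm
  set V := fun k => Var[ξ k; P k] with hV
  set s := fun k => √(V k) with hs
  have hs2 : ∀ k, (s k)⁻¹ ^ 2 = (V k)⁻¹ := fun k => by
    rw [inv_pow, Real.sq_sqrt (variance_nonneg _ _)]
  set a := fun k => ‖ν k‖ ^ 2 + 2 * frobSq (symPart (B k)) with ha
  have hrelV : ∀ k, relErrSq (P k) (ξ k) (fun ω => quadFun (ν k) (B k) (z k ω)) =
      1 - a k / V k := fun k => by
    rw [relErrSq, integral_quadFun_comp_sq (hz k), hvareq]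
  simp_rw [hrelV] at hrel
  have haV : Tendsto (fun k => a k / V k) atTop (𝓝 1) := by
    simpa using (tendsto_const_nhds (x := (1 : ℝ))).sub hrel
  -- The approximation is divided by the standard deviation of `ξ`, not its own, so its variance is
  -- `a / V`, which tends to `1`.
  have hnorm : Tendsto (fun k => ‖(s k)⁻¹ • ν k‖ ^ 2 + 2 * frobSq (symPart ((s k)⁻¹ • B k)))
      atTop (𝓝 1) := by
    refine haV.congr fun k => ?_
    rw [norm_smul, mul_pow, Real.norm_eq_abs, sq_abs, symPart_smul, frobSq_smul, hs2, ha]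
    ring
  have hX : ∀ k, MemLp (fun ω => ξ k ω / s k) 2 (P k) := fun k => by
    simpa only [div_eq_mul_inv] using (hL k).mul_const (s k)⁻¹
  rw [tendstoInDistribution_gaussianReal_iff fun k => (hX k).1.aemeasurable]
  have hop : Tendsto (fun k => opNorm (symPart (B k)) ^ 2 / (‖ν k‖ ^ 2 + frobSq (symPart (B k))))
      atTop (𝓝 0) ↔ Tendsto (fun k => opNorm (symPart ((s k)⁻¹ • B k))) atTop (𝓝 0) := by
    rw [tendsto_div_iff (fun k => sq_nonneg _) hvar
      (fun k => by linarith [frobSq_nonneg (symPart (B k))])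
      (fun k => by linarith [sq_nonneg ‖ν k‖]) haV]
    have e : ∀ k, opNorm (symPart (B k)) ^ 2 / V k = opNorm (symPart ((s k)⁻¹ • B k)) ^ 2 := by
      intro k
      rw [symPart_smul, opNorm_smul, mul_pow, sq_abs, hs2]
      ring
    refine (tendsto_congr e).trans ⟨fun h => ?_, fun h => by simpa using h.pow 2⟩
    have := h.sqrt.congr fun k => Real.sqrt_sq (norm_nonneg _)
    rwa [Real.sqrt_zero] at this
  rw [hop, ← tendsto_charFun_quadFun_iff hnorm]
  refine forall_congr' fun t => ?_
  -- Where the variance is positive, the squared `L²` distance of the two normalized variables is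
  -- exactly the relative error `1 - a / V`.
  have hdiff : Tendsto (fun k => ∫ ω, Complex.exp (t * (ξ k ω / s k : ℝ) * I) ∂(P k) -
      ∫ x, Complex.exp (t * quadFun ((s k)⁻¹ • ν k) ((s k)⁻¹ • B k) x * I)
        ∂(stdGaussian (E (n k)))) atTop (𝓝 0) := by
    have hb : Tendsto (fun k => |t| * √(1 - a k / V k)) atTop (𝓝 0) := by
      simpa using hrel.sqrt.const_mul |t|
    refine squeeze_zero_norm' ?_ hb
    filter_upwards [hvar] with k hk
    have hY := memLp_quadFun_comp (hz k) ((s k)⁻¹ • ν k) ((s k)⁻¹ • B k)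
    rw [← (hz k).integral_comp
      (integrable_cexp_mul_I (memLp_quadFun _ _).1.aemeasurable t).1]
    refine (norm_integral_cexp_sub_le (hX k) hY t).trans (le_of_eq ?_)
    congr 2
    have e : ∀ ω, (ξ k ω / s k - quadFun ((s k)⁻¹ • ν k) ((s k)⁻¹ • B k) (z k ω)) ^ 2 =
        (V k)⁻¹ * (ξ k ω - quadFun (ν k) (B k) (z k ω)) ^ 2 := by
      intro ω
      rw [quadFun_smul, ← hs2, Pi.smul_apply, smul_eq_mul]
      ring
    simp_rw [e]
    rw [integral_const_mul, integral_sub_quadFun_comp_sq (hz k) (hf k) (hξ k) (hcov k), hvareq]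
    have hk' : V k ≠ 0 := ne_of_gt hk
    change (V k)⁻¹ * (V k - a k) = _
    field_simp
  constructor
  · intro h
    simpa using hdiff.add h
  · intro h
    simpa using h.sub hdiff

end QuadApprox

/-- Projection onto the first two Gaussian chaoses, and quadratic approximation, of
`ξ = zᵀ f(z) - div f(z)`. For each `k`, `z k` is standard normal in `ℝ^(n k)`, and `F k` is (any
version of) the weak gradient of `f k`; the dimension `n k`, the function `f k` and the probability
space may all vary with `k`. The first part concerns each `k` separately, the last two are
asymptotic as `k → ∞`. -/
theorem mainTheorem8 {Ω : ℕ → Type*} [∀ k, MeasurableSpace (Ω k)]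
    (P : ∀ k, Measure (Ω k)) [∀ k, IsProbabilityMeasure (P k)]
    (n : ℕ → ℕ) (z : ∀ k, Ω k → E (n k))
    (hz : ∀ k, HasLaw (z k) (stdGaussian (E (n k))) (P k))
    (f : ∀ k, E (n k) → E (n k)) (F : ∀ k, E (n k) → Mat (n k))
    (hf : ∀ k, IsGaussianSobolev (f k) (F k))
    (ξ : ∀ k, Ω k → ℝ) (hξ : ∀ k ω, ξ k ω = steinFun (f k) (F k) (z k ω))
    (μ : ∀ k, E (n k)) (hμ : ∀ k, μ k = meanVec (P k) (z k) (f k))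
    (A : ∀ k, Mat (n k)) (hA : ∀ k, A k = meanMat (P k) (z k) (F k)) :
    (∀ k,
      -- the `L²` projections onto `H_{1,2}`, `H₁` and `H₂`
      (∃ hL : MemLp (ξ k) 2 (P k),
        (chaos12 (hz k)).starProjection (hL.toLp (ξ k)) = quadLp (hz k) (μ k, A k) ∧
        (chaos1 (hz k)).starProjection (hL.toLp (ξ k)) = quadLp (hz k) (μ k, 0) ∧
        (chaos2 (hz k)).starProjection (hL.toLp (ξ k)) = quadLp (hz k) (0, A k)) ∧
      (chaos1 (hz k)).starProjection (quadLp (hz k) (μ k, A k)) = quadLp (hz k) (μ k, 0) ∧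
      (chaos2 (hz k)).starProjection (quadLp (hz k) (μ k, A k)) = quadLp (hz k) (0, A k) ∧
      -- the projection errors
      (∫ ω, (ξ k ω - quadFun (μ k) (A k) (z k ω)) ^ 2 ∂(P k) =
        (∫ ω, (‖f k (z k ω) - μ k‖ ^ 2 - frobSq (A k)) ∂(P k)) +
          ∫ ω, ((F k (z k ω) - A k) ^ 2).trace ∂(P k)) ∧
      ((∫ ω, (‖f k (z k ω) - μ k‖ ^ 2 - frobSq (A k)) ∂(P k)) +
          ∫ ω, ((F k (z k ω) - A k) ^ 2).trace ∂(P k) ≤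
        2 * ∫ ω, frobSq (symPart (F k (z k ω) - A k)) ∂(P k)) ∧
      (∫ ω, (quadFun (μ k) (A k) (z k ω) - quadFun (μ k) 0 (z k ω)) ^ 2 ∂(P k) =
        2 * frobSq (symPart (A k))) ∧
      (∫ ω, (quadFun (μ k) (A k) (z k ω) - quadFun 0 (A k) (z k ω)) ^ 2 ∂(P k) =
        ‖μ k‖ ^ 2) ∧
      -- the bounds on the relative errors, which are defined when `ξ` is not a.s. zero
      (0 < ∫ ω, ξ k ω ^ 2 ∂(P k) →
        relErrSq (P k) (ξ k) (fun ω => quadFun (μ k) (A k) (z k ω)) ≤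
          (2 * ∫ ω, frobSq (symPart (F k (z k ω) - A k)) ∂(P k)) /
            (‖μ k‖ ^ 2 + 2 * ∫ ω, frobSq (symPart (F k (z k ω))) ∂(P k)) ∧
        relErrSq (P k) (ξ k) (fun ω => quadFun 0 (A k) (z k ω)) ≤
          (‖μ k‖ ^ 2 + 2 * ∫ ω, frobSq (symPart (F k (z k ω) - A k)) ∂(P k)) /
            (‖μ k‖ ^ 2 + 2 * ∫ ω, frobSq (symPart (F k (z k ω))) ∂(P k)))) ∧
    -- asymptotic normality when the relative error of the projection onto `H_{1,2}` is `o(1)`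
    ((∀ᶠ k in atTop, 0 < Var[ξ k; P k]) →
      Tendsto (fun k => relErrSq (P k) (ξ k) (fun ω => quadFun (μ k) (A k) (z k ω)))
        atTop (𝓝 0) →
      (Tendsto (fun k => opNorm (symPart (A k)) ^ 2 / (‖μ k‖ ^ 2 + frobSq (symPart (A k))))
          atTop (𝓝 0) ↔
        TendstoInDistribution (fun k ω => ξ k ω / √(Var[ξ k; P k]))
          atTop (id : ℝ → ℝ) P (gaussianReal 0 1))) ∧
    -- asymptotic normality when the relative error of the projection onto `H₂` is `o(1)`
    ((∀ᶠ k in atTop, 0 < Var[ξ k; P k]) →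
      Tendsto (fun k => relErrSq (P k) (ξ k) (fun ω => quadFun 0 (A k) (z k ω)))
        atTop (𝓝 0) →
      (Tendsto (fun k => opNorm (symPart (A k)) ^ 2 / frobSq (symPart (A k)))
          atTop (𝓝 0) ↔
        TendstoInDistribution (fun k ω => ξ k ω / √(Var[ξ k; P k]))
          atTop (id : ℝ → ℝ) P (gaussianReal 0 1))) := by
  have hμ' : ∀ k i, ∫ x, f k x i ∂(stdGaussian (E (n k))) = μ k i := fun k i => by
    rw [hμ, meanVec_apply (hz k) (hf k)]
  have hA' : ∀ k i j, ∫ x, F k x i j ∂(stdGaussian (E (n k))) = A k i j := fun k i j => by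
    rw [hA, meanMat_apply (hz k) (hf k)]
  refine ⟨fun k => error_bounds (hz k) (hf k) (hξ k) (hμ k) (hA k), fun hvar hrel => ?_,
    fun hvar hrel => ?_⟩
  · exact tendsto_opNorm_iff_tendstoInDistribution hz hf hξ
      (fun k => (hf k).integral_steinFun_mul_quadFun_mean (hμ' k) (hA' k)) hvar hrel
  -- The projection onto `H₂` satisfies the same covariance condition with `ν = 0`, which removes
  -- `‖ν‖²` from the ratio.
  · have hcov : ∀ k, ∫ x, steinFun (f k) (F k) x * quadFun 0 (A k) x ∂(stdGaussian (E (n k))) =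
        ‖(0 : E (n k))‖ ^ 2 + 2 * frobSq (symPart (A k)) := fun k => by
      rw [(hf k).integral_steinFun_mul_quadFun (hμ' k) (hA' k), ← integral_quadFun_sq]
      simp_rw [sq]
      rw [integral_quadFun_mul_quadFun]
      simp
    simpa using tendsto_opNorm_iff_tendstoInDistribution hz hf hξ hcov hvar hrel
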